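/- **Setting.** Let $T$ tasks be given, with transformations $g_t:(\mathbb R^{d_x})^{t-1}\to\mathbb R^{d_x}$ for $1<t\le T$ (measurable). A first input $x_1\sim\mathcal D_1$ generates the trajectory $x_t=g_t(x_1,\dots,x_{t-1})$. Let $\mathcal F=\{f_\theta:\theta\in\Theta\}$, $\Theta\subset\mathbb R^p$ bounded, be a class of measurable maps $\mathbb R^{d_x}\to\mathbb R^{d_y}$, and let $f^*=f_{\theta^*}$ with $\theta^*\in\Theta$. Draw $x_{11},\dots,x_{1m}$ i.i.d. from $\mathcal D_1$, let $x_{ti}=g_t(x_{1i},\dots,x_{t-1,i})$ and $y_{ti}=f^*(x_{ti})+v_{ti}$. For each task $t$ only the samples with $i$ in a fixed set $\mathcal R_t\subset[m]$ are stored; $n_t=|\mathcal R_t|$, $N=\sum_t n_t$. Let $w_t\ge 0$ be weights, $\lambda\ge 0$, and $\Omega_T:\Theta\to[0,\infty)$ a regularizer, all independent of the data, and let $\hat\theta_T\in\Theta$ be a global minimizer over $\Theta$ of $$\frac1T\sum_{t}\sum_{i\in\mathcal R_t}\frac{w_t}{n_t}\|f_\theta(x_{ti})-y_{ti}\|_2^2+\lambda\,\Omega_T(\theta).$$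 Write $G_{f,t}(x_1)=f(x_t)-f^*(x_t)$, where $x_t$ is regarded as a function of $x_1$; for a fixed $q\in[1,\infty)$ let $\|h\|_{\mathcal F}=\frac1T\sum_t(\mathbb E\|h(x_t)\|_q^q)^{1/q}$, and $$M_2=\sup_{f\in\mathcal F}\ \sup_{t:\,w_t>0}\mathbb E\|G_{f,t}(x_1)\|_2^2,\qquad \kappa=\sup_{f\in\mathcal F\setminus\{f^*\}}\ \sup_{t:\,w_t>0}\frac{(\mathbb E\|G_{f,t}(x_1)\|_2^4)^{1/2}}{\mathbb E\|G_{f,t}(x_1)\|_2^2}\in[0,\infty].$$ **Parameters.** Let $\delta\in(0,1]$, $C>1$, $\sigma,\nu\ge0$, $L_{\mathcal F},L_G,k_G,\alpha>0$, $c_\lambda\ge 0$, and put $$r_v=2\nu\Big(\sqrt{d_y}+8\sqrt{2\ln(4m/\delta)}\Big),\qquad \ell=p\ln\!\big(1+2L_{\mathcal F}\,\mathrm{diam}(\Theta)\,N\,(1+4r_v)\big)+\ln(4/\delta),$$ $$\Lambda=\frac{4m}\delta\Big(1+\frac{64\,N\,L_G\sigma\,(L_G\sigma+\sqrt{M_2})}{k_G\sigma^\alpha}\Big),\qquad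 r_x=\sigma\Big(3+16\sqrt{\ln\Lambda/d_x}\Big)$$ (with $\Lambda=4m/\delta$ if $\sigma=0$). **Assumptions.** 1. $x_1$ is a sub-Gaussian vector with independent coordinates and proxy variance $\sigma^2/d_x$. Conditionally on the inputs, the noise vectors $v_{ti}$ are independent, each sub-Gaussian with independent coordinates and proxy variance $\nu^2$. 2. $\mathbb E\|f(x_t)\|_q^q<\infty$ for all $f\in\mathcal F$ and $t\in[T]$; $\mathbb E\|G_{f,t}(x_1)\|_2^4<\infty$ and $\mathbb E\|G_{f,t}(x_1)\|_2^2>0$ for all $f\in\mathcal F\setminus\{f^*\}$ and $t\in[T]$. 3. $\|f_\theta-f_{\theta'}\|_{\mathcal F}\le L_{\mathcal F}\|\theta-\theta'\|_2$ for all $\theta,\theta'\in\Theta$, and every $G_{f,t}$ is $L_G$-Lipschitz on $\mathbb R^{d_x}$. For all $f,f'\in\mathcal F$, $t\in[T]$ and $\|z\|_2\le r_x$, both $\|G_{f,t}(z)-G_{f',t}(z)\|_2$ and $\big|\|G_{f,t}(z)\|_2^2-\|G_{f',t}(z)\|_2^2\big|$ are at most $K_G\|f-f'\|_{\mathcal F}$,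 with $K_G=k_Gr_x^\alpha$. 4. $n_t\ge \dfrac{2C^2}{(C-1)^2}\,\kappa^2\,\ell$ for every $t$ with $w_t>0$, and $\lambda\le c_\lambda\cdot\frac1T\max_t\frac{w_t}{n_t}$. **Conclusion.** With probability at least $1-\delta$, for an independent fresh trajectory $(x_t)_t$ over which the expectation is taken, $$\frac1T\sum_{t=1}^T w_t\,\mathbb E\|f^*(x_t)-f_{\hat\theta_T}(x_t)\|_2^2\ \le\ \frac{8C\nu^2\,\ell+4C\,k_G\,\sigma^\alpha\big(3+16\sqrt{\ln\Lambda/d_x}\big)^\alpha+2C\,c_\lambda\,\Omega_T(\theta^*)}{T}\cdot\max_{t}\frac{w_t}{n_t}.$$ That is, if $C$, $k_G$, $c_\lambda\Omega_T(\theta^*)$ are treated as constants and logarithmic factors are suppressed, the error is $\tilde{\mathcal O}\Big(\frac{\nu^2(p+\ln(1/\delta))+\mathrm{poly}(\sigma)}{T}\max_t\frac{w_t}{n_t}\Big)$. -/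

import Mathlib

open MeasureTheory ProbabilityTheory

noncomputable section

/-- `ℝᵈ` with the Euclidean norm. -/
abbrev Vec (d : ℕ) : Type := EuclideanSpace ℝ (Fin d)

/-- The law `P` on `ℝᵈ` is that of a sub-Gaussian vector with proxy variance `c` and independent
coordinates: `E exp (s ⟨u, z⟩) ≤ exp (c s² / 2)` for all real `s` and all unit vectors `u`.
(The bound, with integrability of the exponentials, forces the mean to be zero.) -/
def IsSubGaussianVec {d : ℕ} (c : NNReal) (P : Measure (Vec d)) : Prop :=
  iIndepFun (fun (k : Fin d) (z : Vec d) => z k) P ∧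
    ∀ u : Vec d, ‖u‖ = 1 → HasSubgaussianMGF (fun z : Vec d => inner ℝ u z) c P

/-- Trajectory generated by the first input `z` through the autoregressive transformations `g`.
Tasks are numbered from `0`, so the input of task `t > 0` is `g t` applied to the inputs of the
`t` tasks `0, …, t - 1`. (The value of `g` at `0` is never used.) -/
def traj {d : ℕ} (g : (t : ℕ) → (Fin t → Vec d) → Vec d) (z : Vec d) : ℕ → Vec d
  | 0 => z
  | t + 1 => g (t + 1) (fun s : Fin (t + 1) => traj g z s.val)
decreasing_by exact s.isLt

/-- The deterministic data of continual nonlinear regression by weighted experience replay: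
`T` tasks, `m` trajectories, inputs in `ℝ^dx`, outputs in `ℝ^dy`, parameters in `ℝ^p`. -/
structure ReplayModel (dx dy p T m : ℕ) where
  /-- law of the input of the first task -/
  D : Measure (Vec dx)
  /-- task dependency -/
  g : (t : ℕ) → (Fin t → Vec dx) → Vec dx
  /-- parameter set -/
  Θ : Set (Vec p)
  /-- parametrized predictors -/
  f : Vec p → Vec dx → Vec dy
  /-- a parameter of the true predictor `f* = f θstar` -/
  θstar : Vec p
  /-- weights of the tasks -/
  w : Fin T → ℝ
  /-- indices of the stored samples of each task -/
  R : Fin T → Finset (Fin m)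
  /-- regularizer -/
  reg : Vec p → ℝ
  /-- regularization parameter -/
  lam : ℝ

namespace ReplayModel

variable {dx dy p T m : ℕ} (P : ReplayModel dx dy p T m)

/-- The input of task `t` as a function of the input `z` of the first task. -/
def x (t : Fin T) (z : Vec dx) : Vec dx := traj P.g z t.val

/-- Number `n_t` of stored samples of task `t`. -/
def n (t : Fin T) : ℕ := (P.R t).card

/-- Total number of stored samples. -/
def total : ℕ := ∑ t, P.n t

/-- Direct difference map `G_{f,t}`, for `f = f θ`. -/
def G (θ : Vec p) (t : Fin T) (z : Vec dx) : Vec dy := P.f θ (P.x t z) - P.f P.θstar (P.x t z)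

/-- `E ‖G_{f,t}(x₁)‖²` -/
def m2 (θ : Vec p) (t : Fin T) : ℝ := ∫ z, ‖P.G θ t z‖ ^ 2 ∂P.D

/-- `E ‖G_{f,t}(x₁)‖⁴` -/
def m4 (θ : Vec p) (t : Fin T) : ℝ := ∫ z, ‖P.G θ t z‖ ^ 4 ∂P.D

/-- The norm `‖h‖_F = (1/T) ∑ₜ (E ‖h(xₜ)‖_q^q)^(1/q)`, where `‖·‖_q` is the `ℓ^q` norm. -/
def fnorm (q : ℝ) (h : Vec dx → Vec dy) : ℝ :=
  1 / (T : ℝ) * ∑ t : Fin T, (∫ z, ∑ k, |h (P.x t z) k| ^ q ∂P.D) ^ (1 / q)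

/-- `κ`, the supremum over `f ≠ f*` in the class and over tasks of positive weight of
`(E ‖G_{f,t}(x₁)‖⁴)^(1/2) / E ‖G_{f,t}(x₁)‖²`, with value in `[0, ∞]`. -/
def kappa : ENNReal :=
  ⨆ θ ∈ P.Θ, ⨆ _ : P.f θ ≠ P.f P.θstar, ⨆ t : Fin T, ⨆ _ : 0 < P.w t,
    ENNReal.ofReal (√(P.m4 θ t) / P.m2 θ t)

/-- `M₂`, the supremum over the class and over tasks of positive weight of `E ‖G_{f,t}(x₁)‖²`
(it is finite under the assumptions below). -/
def M2 : ℝ := sSup {a | ∃ θ ∈ P.Θ, ∃ t : Fin T, 0 < P.w t ∧ a = P.m2 θ t}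

/-- `max_t w_t / n_t` -/
def maxRatio : ℝ := ⨆ t : Fin T, P.w t / (P.n t : ℝ)

/-- Weighted estimation error `(1/T) ∑ₜ w_t E ‖f*(xₜ) - f_θ(xₜ)‖²`; the expectation is over a fresh
trajectory. -/
def err (θ : Vec p) : ℝ :=
  1 / (T : ℝ) * ∑ t, P.w t * ∫ z, ‖P.f P.θstar (P.x t z) - P.f θ (P.x t z)‖ ^ 2 ∂P.D

/-- The objective of weighted replay at `θ`, when the first-task inputs are `ξ i` and the noise
of sample `i` of task `t` is `v (t, i)`; so that sample is `(P.x t (ξ i), f*(P.x t (ξ i)) + v (t, i))`. -/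
def objective (ξ : Fin m → Vec dx) (v : Fin T × Fin m → Vec dy) (θ : Vec p) : ℝ :=
  1 / (T : ℝ) * ∑ t, ∑ i ∈ P.R t, P.w t / (P.n t : ℝ) *
      ‖P.f θ (P.x t (ξ i)) - (P.f P.θstar (P.x t (ξ i)) + v (t, i))‖ ^ 2
    + P.lam * P.reg θ

/-- Standing conventions: the maps are measurable, the weights, the regularization parameter and
the regularizer are nonnegative. -/
structure Regular : Prop where
  prob : IsProbabilityMeasure P.D
  meas_g : ∀ t, 0 < t → t < T → Measurable (P.g t)
  meas_f : ∀ θ ∈ P.Θ, Measurable (P.f θ)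
  w_nonneg : ∀ t, 0 ≤ P.w t
  lam_nonneg : 0 ≤ P.lam
  reg_nonneg : ∀ θ ∈ P.Θ, 0 ≤ P.reg θ

/-- The parameter set is bounded and the true predictor is realizable. -/
def BoundedRealizable : Prop := Bornology.IsBounded P.Θ ∧ P.θstar ∈ P.Θ

/-- The class lies in `L^q` of the inputs of all tasks. -/
def InLq (q : ℝ) : Prop :=
  ∀ θ ∈ P.Θ, ∀ t : Fin T, Integrable (fun z => ∑ k, |P.f θ (P.x t z) k| ^ q) P.D

/-- Finite fourth and nondegenerate second moments of the direct difference maps. -/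
def FiniteMoments : Prop :=
  ∀ θ ∈ P.Θ, P.f θ ≠ P.f P.θstar → ∀ t : Fin T,
    Integrable (fun z => ‖P.G θ t z‖ ^ 4) P.D ∧ 0 < P.m2 θ t

/-- Lipschitz conditions on the class and on the direct difference maps; the constant in the last
two conditions, on the ball of radius `r`, is `K`. -/
structure LipschitzConditions (q LF LG r K : ℝ) : Prop where
  class_lipschitz : ∀ θ ∈ P.Θ, ∀ θ' ∈ P.Θ,
    P.fnorm q (fun z => P.f θ z - P.f θ' z) ≤ LF * ‖θ - θ'‖
  G_lipschitz : ∀ θ ∈ P.Θ, ∀ (t : Fin T) (z z' : Vec dx), ‖P.G θ t z - P.G θ t z'‖ ≤ LG * ‖z - z'‖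
  ball : ∀ θ ∈ P.Θ, ∀ θ' ∈ P.Θ, ∀ (t : Fin T) (z : Vec dx), ‖z‖ ≤ r →
    ‖P.G θ t z - P.G θ' t z‖ ≤ K * P.fnorm q (fun z => P.f θ z - P.f θ' z)
  ball_sq : ∀ θ ∈ P.Θ, ∀ θ' ∈ P.Θ, ∀ (t : Fin T) (z : Vec dx), ‖z‖ ≤ r →
    |‖P.G θ t z‖ ^ 2 - ‖P.G θ' t z‖ ^ 2| ≤ K * P.fnorm q (fun z => P.f θ z - P.f θ' z)

/-- `r_v = 2ν (√dy + 8 √(2 ln (4m/δ)))` -/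
def noiseRadius (_P : ReplayModel dx dy p T m) (ν δ : ℝ) : ℝ :=
  2 * ν * (√(dy : ℝ) + 8 * √(2 * Real.log (4 * m / δ)))

/-- `p ln (1 + 2 LF diam(Θ) (∑ₜ n_t) (1 + 4 r_v)) + ln (4/δ)` -/
def complexity (LF ν δ : ℝ) : ℝ :=
  p * Real.log (1 + 2 * (LF * Metric.diam P.Θ) * P.total * (1 + 4 * P.noiseRadius ν δ))
    + Real.log (4 / δ)

/-- `Λ = (4m/δ) (1 + 64 (∑ₜ n_t) LG σ (LG σ + √M₂) / (kG σ^α))` -/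
def tailFactor (LG kG α σ δ : ℝ) : ℝ :=
  4 * m / δ * (1 + 64 * P.total * (LG * σ) * (LG * σ + √P.M2) / (kG * σ ^ α))

/-- `r_x = σ (3 + 16 √(ln Λ / dx))` -/
def inputRadius (LG kG α σ δ : ℝ) : ℝ :=
  σ * (3 + 16 * √(Real.log (P.tailFactor LG kG α σ δ) / dx))

end ReplayModel

/-- Given the inputs `X`, the noise vectors `V (t, i)` are independent of each other, and each is
sub-Gaussian with proxy variance `ν²` and independent coordinates. The inputs of all tasks are
functions of those of the first task, so that conditioning on `X` is conditioning on them all. -/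
def IsCondSubGaussianNoise {Ω : Type*} [MeasurableSpace Ω] (μ : Measure Ω) [IsFiniteMeasure μ]
    {dx dy T m : ℕ} (X : Fin m → Ω → Vec dx) (V : Fin T × Fin m → Ω → Vec dy) (ν : NNReal) :
    Prop :=
  ∀ᵐ ξ ∂(μ.map (fun ω i => X i ω)),
    iIndepFun (fun (j : Fin T × Fin m) (v : Fin T × Fin m → Vec dy) => v j)
      (condDistrib (fun ω j => V j ω) (fun ω i => X i ω) μ ξ) ∧
    ∀ j : Fin T × Fin m, IsSubGaussianVec (ν ^ 2)
      ((condDistrib (fun ω j => V j ω) (fun ω i => X i ω) μ ξ).map (fun v => v j))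

end

/-! Write A for `maxRatio`, N for `total`, ℓ for `complexity` and K for `kG * inputRadius ^ α`.
Comparing the objective at the minimizer with its value at `θstar`, and doubling, gives `empErr ≤ 4
noiseCorr - empErr + 2 T λ Ω(θ*)` (`empErr_le_of_isMinOn`). The subtracted empirical error is an
offset that makes localization unnecessary: for fixed θ and fixed inputs, the sub-Gaussian variance
of the noise term is quadratic in `G` and is cancelled by the offset. Hence `4 noiseCorr - empErr`
exceeds 8ν²ℓA with probability at most exp(-ℓ) (`lintegral_exp_offset_le_one`,
`measure_lt_noiseCorr_sub_le`).

For fixed θ the population error is at most C times the empirical one, up to probability exp(-ℓ).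
This is a lower-tail bound for sums of nonnegative independent variables, which needs only second
moments (`measureReal_sum_le_le_exp`). The variables are the contributions of whole trajectories:
tasks are dependent within a trajectory, but the bound κ on the moment ratio survives nonnegative
combinations (`integral_sum_sq_le`), and the lower bound on the n_t prevents any trajectory from
dominating.

Both statements are made uniform by a union bound over a finite net of Θ, whose cardinality times
exp(-ℓ) is at most δ/4. Passing from the minimizer to a nearby net point costs multiples of A K,
provided that all inputs lie in the ball of radius `inputRadius` and the average noise norm is at
most `noiseRadius`; these two events take the other two quarters of δ. The population error also
sees inputs outside the ball. There the global Lipschitz bound and the sub-Gaussian tail are used,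
and Λ is large enough for this part to cost at most K/N per task (`total_mul_m2_le`).
`sum_mul_m2_le_of_isMinOn` adds up the costs. -/

/-! ### Covering numbers of bounded sets. -/

/-- Volume comparison: the balls of radius ε/2 about the points are disjoint and lie in one ball of
radius D + ε/2. -/
theorem card_le_of_separated {E : Type*} [NormedAddCommGroup E] [NormedSpace ℝ E]
    [FiniteDimensional ℝ E] {ε D : ℝ} (hε : 0 < ε) (hD : 0 ≤ D) (x₀ : E) (s : Finset E)
    (hs : ∀ x ∈ s, dist x x₀ ≤ D) (hsep : ∀ x ∈ s, ∀ y ∈ s, x ≠ y → ε < dist x y) :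
    (s.card : ℝ) ≤ (1 + 2 * D / ε) ^ Module.finrank ℝ E := by
  borelize E
  let μ : Measure E := Measure.addHaar
  have hdisj : (s : Set E).PairwiseDisjoint fun x => Metric.ball x (ε / 2) := by
    intro x hx y hy hxy
    exact Metric.ball_disjoint_ball (by linarith [hsep x hx y hy hxy])
  have hsub : (⋃ x ∈ s, Metric.ball x (ε / 2)) ⊆ Metric.ball x₀ (D + ε / 2) := by
    intro y hy
    simp only [Set.mem_iUnion] at hy
    obtain ⟨x, hx, hy⟩ := hy
    rw [Metric.mem_ball] at hy ⊢
    linarith [dist_triangle y x x₀, hs x hx]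
  have hmeas : μ (⋃ x ∈ s, Metric.ball x (ε / 2)) = ∑ x ∈ s, μ (Metric.ball x (ε / 2)) :=
    measure_biUnion_finset hdisj fun _ _ => measurableSet_ball
  have hle := measure_mono (μ := μ) hsub
  rw [hmeas, Measure.addHaar_ball_of_pos _ _ (by positivity)] at hle
  simp_rw [fun x : E => Measure.addHaar_ball_of_pos μ x (r := ε / 2) (by positivity)] at hle
  rw [Finset.sum_const, nsmul_eq_mul, ← mul_assoc] at hle
  have h0 : μ (Metric.ball (0 : E) 1) ≠ 0 := (Metric.measure_ball_pos μ 0 one_pos).ne'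
  have htop : μ (Metric.ball (0 : E) 1) ≠ ⊤ := measure_ball_lt_top.ne
  rw [ENNReal.mul_le_mul_iff_left h0 htop, ← ENNReal.ofReal_natCast,
    ← ENNReal.ofReal_mul (by positivity), ENNReal.ofReal_le_ofReal_iff (by positivity)] at hle
  have heq : D + ε / 2 = (1 + 2 * D / ε) * (ε / 2) := by
    field_simp
    ring
  rw [heq, mul_pow] at hle
  exact le_of_mul_le_mul_right hle (by positivity)

/-- A separated subset of maximal cardinality is a net, since a point far from it could be added.
The net lies inside `A`, so that hypotheses on Θ apply to its points. -/
theorem exists_finset_net {E : Type*} [NormedAddCommGroup E] [NormedSpace ℝ E]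
    [FiniteDimensional ℝ E] {ε : ℝ} (hε : 0 < ε) {A : Set E} (hA : Bornology.IsBounded A) :
    ∃ s : Finset E, (s : Set E) ⊆ A ∧ (∀ x ∈ A, ∃ y ∈ s, dist x y ≤ ε) ∧
      (s.card : ℝ) ≤ (1 + 2 * Metric.diam A / ε) ^ Module.finrank ℝ E := by
  classical
  let S : Set ℕ := {k | ∃ s : Finset E, (s : Set E) ⊆ A ∧
    (∀ x ∈ s, ∀ y ∈ s, x ≠ y → ε < dist x y) ∧ s.card = k}
  have hbound : ∀ s : Finset E, (s : Set E) ⊆ A → (∀ x ∈ s, ∀ y ∈ s, x ≠ y → ε < dist x y) →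
      (s.card : ℝ) ≤ (1 + 2 * Metric.diam A / ε) ^ Module.finrank ℝ E := by
    intro s hsA hsep
    rcases s.eq_empty_or_nonempty with rfl | ⟨x₀, hx₀⟩
    · have := Metric.diam_nonneg (s := A)
      simp only [Finset.card_empty, Nat.cast_zero]
      positivity
    · exact card_le_of_separated hε Metric.diam_nonneg x₀ s
        (fun x hx => Metric.dist_le_diam_of_mem hA (hsA hx) (hsA hx₀)) hsep
  have hne : S.Nonempty := ⟨0, ∅, by simp, by simp, by simp⟩
  have hbdd : BddAbove S := by
    refine ⟨⌊(1 + 2 * Metric.diam A / ε) ^ Module.finrank ℝ E⌋₊, ?_⟩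
    rintro k ⟨s, hsA, hsep, rfl⟩
    exact Nat.le_floor (hbound s hsA hsep)
  obtain ⟨s, hsA, hsep, hcard⟩ := Nat.sSup_mem hne hbdd
  refine ⟨s, hsA, fun x hx => ?_, hbound s hsA hsep⟩
  by_contra! hfar
  have hxs : x ∉ s := fun h => by
    have := hfar x h
    rw [dist_self] at this
    linarith
  have hmem : s.card + 1 ∈ S := by
    refine ⟨insert x s, ?_, ?_, Finset.card_insert_of_notMem hxs⟩
    · rw [Finset.coe_insert]
      exact Set.insert_subset hx hsA
    · intro a ha b hb hab
      rw [Finset.mem_insert] at ha hb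
      rcases ha with rfl | ha <;> rcases hb with rfl | hb
      · exact absurd rfl hab
      · exact hfar b hb
      · rw [dist_comm]
        exact hfar a ha
      · exact hsep a ha b hb hab
  have := le_csSup hbdd hmem
  omega

/-! ### Exponential square moments and tails of sub-Gaussian vectors. -/

theorem lintegral_exp_sq_gaussianReal {c : NNReal} (hc : 0 < c) :
    ∫⁻ s, ENNReal.ofReal (Real.exp (c * s ^ 2 / 2)) ∂(gaussianReal 0 (2 * c)⁻¹)
      = ENNReal.ofReal √2 := by
  have hc' : (0 : ℝ) < c := hc
  have hv : (2 * c)⁻¹ ≠ 0 := by positivity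
  rw [gaussianReal_of_var_ne_zero _ hv,
    lintegral_withDensity_eq_lintegral_mul _ (measurable_gaussianPDF _ _) (by fun_prop)]
  have hpt : ∀ s : ℝ, (gaussianPDF 0 (2 * c)⁻¹ *
      fun s : ℝ => ENNReal.ofReal (Real.exp (c * s ^ 2 / 2))) s
      = ENNReal.ofReal (√(c / Real.pi) * Real.exp (-(c / 2) * s ^ 2)) := by
    intro s
    rw [Pi.mul_apply, gaussianPDF, ← ENNReal.ofReal_mul (gaussianPDFReal_nonneg _ _ _),
      gaussianPDFReal]
    congr 1
    rw [mul_assoc, ← Real.exp_add]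
    push_cast
    congr 1
    · rw [← Real.sqrt_inv]
      congr 1
      field_simp
    · congr 1
      field_simp
      ring
  simp_rw [hpt]
  rw [← ofReal_integral_eq_lintegral_ofReal, integral_const_mul, integral_gaussian,
    ← Real.sqrt_mul (by positivity)]
  · congr 2
    field_simp
  · exact (integrable_exp_neg_mul_sq (by positivity)).const_mul _
  · exact Filter.Eventually.of_forall fun s => by positivity

/-- Gaussian linearization: exp(z²/(4c)) is the average of exp(z s) over s of law N(0, 1/(2c)).
After exchanging the integrals, the bound on the moment generating function of Z applies for each s,
and a Gaussian integral remains. -/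
theorem lintegral_exp_sq_le_of_hasSubgaussianMGF {Ω : Type*} [MeasurableSpace Ω] {μ : Measure Ω}
    [SFinite μ] {Z : Ω → ℝ} {c : NNReal} (hc : 0 < c) (hZ : Measurable Z)
    (h : HasSubgaussianMGF Z c μ) :
    ∫⁻ ω, ENNReal.ofReal (Real.exp (Z ω ^ 2 / (4 * c))) ∂μ ≤ ENNReal.ofReal √2 := by
  have hc' : (0 : ℝ) < c := hc
  have hpt : ∀ z : ℝ, ENNReal.ofReal (Real.exp (z ^ 2 / (4 * c)))
      = ∫⁻ s, ENNReal.ofReal (Real.exp (z * s)) ∂(gaussianReal 0 (2 * c)⁻¹) := by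
    intro z
    have := mgf_gaussianReal (p := gaussianReal 0 (2 * c)⁻¹) (X := id) (μ := 0)
      (v := (2 * c)⁻¹) (by simp) z
    rw [← ofReal_integral_eq_lintegral_ofReal (integrable_exp_mul_gaussianReal z)
      (Filter.Eventually.of_forall fun s => by positivity)]
    rw [mgf] at this
    simp only [id] at this
    rw [this]
    congr 2
    push_cast
    field_simp
    ring
  simp_rw [hpt]
  rw [lintegral_lintegral_swap (by fun_prop), ← lintegral_exp_sq_gaussianReal hc]
  refine lintegral_mono fun s => ?_
  rw [← ofReal_integral_eq_lintegral_ofReal]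
  · refine ENNReal.ofReal_le_ofReal ?_
    have := h.mgf_le s
    rw [mgf] at this
    simpa only [mul_comm] using this
  · simpa only [mul_comm] using h.integrable_exp_mul s
  · exact Filter.Eventually.of_forall fun s => by positivity

theorem IsSubGaussianVec.hasSubgaussianMGF_apply {d : ℕ} {c : NNReal} {P : Measure (Vec d)}
    (h : IsSubGaussianVec c P) (k : Fin d) : HasSubgaussianMGF (fun z : Vec d => z k) c P := by
  have := h.2 (EuclideanSpace.single k 1) (by simp)
  simpa [EuclideanSpace.inner_single_left] using this

theorem IsSubGaussianVec.lintegral_exp_norm_sq_le {d : ℕ} {c : NNReal} {P : Measure (Vec d)}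
    [SFinite P] (hc : 0 < c) (h : IsSubGaussianVec c P) :
    ∫⁻ z, ENNReal.ofReal (Real.exp (‖z‖ ^ 2 / (4 * c))) ∂P ≤ ENNReal.ofReal (√2 ^ d) := by
  have hpt : ∀ z : Vec d, ENNReal.ofReal (Real.exp (‖z‖ ^ 2 / (4 * c)))
      = ∏ k : Fin d, ENNReal.ofReal (Real.exp (z k ^ 2 / (4 * c))) := by
    intro z
    rw [← ENNReal.ofReal_prod_of_nonneg fun _ _ => by positivity, ← Real.exp_sum,
      EuclideanSpace.norm_sq_eq, Finset.sum_div]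
    simp
  have hind : iIndepFun (fun (k : Fin d) (z : Vec d) =>
      ENNReal.ofReal (Real.exp (z k ^ 2 / (4 * c)))) P :=
    h.1.comp (fun _ x => ENNReal.ofReal (Real.exp (x ^ 2 / (4 * c)))) fun _ => by fun_prop
  simp_rw [hpt]
  have := lintegral_prod_eq_prod_lintegral_of_indepFun Finset.univ _ hind
    fun _ => by fun_prop
  rw [this]
  calc _ ≤ ∏ k : Fin d, ENNReal.ofReal √2 := Finset.prod_le_prod' fun k _ =>
        lintegral_exp_sq_le_of_hasSubgaussianMGF hc (by fun_prop) (h.hasSubgaussianMGF_apply k)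
    _ = _ := by simp [ENNReal.ofReal_pow]

theorem IsSubGaussianVec.ae_eq_zero {d : ℕ} {P : Measure (Vec d)}
    (h : IsSubGaussianVec 0 P) : ∀ᵐ z ∂P, z = 0 := by
  have : ∀ᵐ z ∂P, ∀ k, z k = 0 := by
    rw [ae_all_iff]
    exact fun k => (h.hasSubgaussianMGF_apply k).ae_eq_zero_of_hasSubgaussianMGF_zero
  filter_upwards [this] with z hz
  ext k
  exact hz k

theorem IsSubGaussianVec.hasSubgaussianMGF_inner {d : ℕ} {c : NNReal} {P : Measure (Vec d)}
    [IsProbabilityMeasure P] (h : IsSubGaussianVec c P) (y : Vec d) :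
    HasSubgaussianMGF (fun z : Vec d => inner ℝ y z) (‖y‖₊ ^ 2 * c) P := by
  rcases eq_or_ne y 0 with rfl | hy
  · simp
  · have hn : ‖y‖ ≠ 0 := norm_ne_zero_iff.2 hy
    have := (h.2 (‖y‖⁻¹ • y) (by rw [norm_smul, norm_inv, norm_norm, inv_mul_cancel₀ hn])).const_mul
      ‖y‖
    convert! this using 2 with z
    rw [real_inner_smul_left, mul_inv_cancel_left₀ hn]

theorem IsSubGaussianVec.integrable_norm_sq {d : ℕ} {c : NNReal} {P : Measure (Vec d)}
    (h : IsSubGaussianVec c P) : Integrable (fun z : Vec d => ‖z‖ ^ 2) P := by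
  simp_rw [EuclideanSpace.norm_sq_eq]
  refine integrable_finsetSum _ fun k _ => ?_
  simpa using ((h.hasSubgaussianMGF_apply k).memLp 2).integrable_sq

theorem sqrt_two_pow_le_exp (d : ℕ) : √2 ^ d ≤ Real.exp (d / 2) := by
  have h : √2 ≤ Real.exp (1 / 2) := by
    rw [Real.sqrt_le_left (Real.exp_pos _).le, ← Real.exp_nat_mul]
    have := Real.add_one_le_exp (1 : ℝ)
    norm_num at this ⊢
    exact this
  calc √2 ^ d ≤ Real.exp (1 / 2) ^ d := by gcongr
    _ = Real.exp (d / 2) := by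
      rw [← Real.exp_nat_mul]
      congr 1
      ring

/-- By 1 + x ≤ exp x, the exponential square moment gives E Z²/(4c) ≤ √2 - 1 ≤ 1/2. The constant is
not sharp, but enough for the radii below. -/
theorem integral_sq_le_of_hasSubgaussianMGF {Ω : Type*} [MeasurableSpace Ω] {μ : Measure Ω}
    [IsProbabilityMeasure μ] {Z : Ω → ℝ} {c : NNReal} (hZ : Measurable Z)
    (h : HasSubgaussianMGF Z c μ) : ∫ ω, Z ω ^ 2 ∂μ ≤ 2 * c := by
  rcases eq_or_ne c 0 with rfl | hc
  · have : (fun ω => Z ω ^ 2) =ᵐ[μ] fun _ => 0 := by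
      filter_upwards [h.ae_eq_zero_of_hasSubgaussianMGF_zero] with ω hω
      rw [hω]
      simp
    rw [integral_congr_ae this]
    simp
  have hc0 : 0 < c := pos_iff_ne_zero.2 hc
  have hc' : (0 : ℝ) < c := hc0
  have hexp := lintegral_exp_sq_le_of_hasSubgaussianMGF hc0 hZ h
  have hint : Integrable (fun ω => Real.exp (Z ω ^ 2 / (4 * c))) μ := by
    refine ⟨by fun_prop, ?_⟩
    rw [hasFiniteIntegral_iff_ofReal (Filter.Eventually.of_forall fun ω => by positivity)]
    exact hexp.trans_lt ENNReal.ofReal_lt_top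
  rw [← ofReal_integral_eq_lintegral_ofReal hint
    (Filter.Eventually.of_forall fun ω => by positivity),
    ENNReal.ofReal_le_ofReal_iff (by positivity)] at hexp
  have hsq : Integrable (fun ω => Z ω ^ 2) μ := (h.memLp 2).integrable_sq
  have hle : ∫ ω, (1 + Z ω ^ 2 / (4 * c)) ∂μ ≤ ∫ ω, Real.exp (Z ω ^ 2 / (4 * c)) ∂μ :=
    integral_mono ((integrable_const _).add (hsq.div_const _)) hint fun ω => by
      simpa only [add_comm] using Real.add_one_le_exp (Z ω ^ 2 / (4 * c))
  rw [integral_add (integrable_const _) (hsq.div_const _), integral_div] at hle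
  simp only [integral_const, probReal_univ, smul_eq_mul, mul_one] at hle
  have h32 : √2 ≤ 3 / 2 := by
    rw [Real.sqrt_le_left (by norm_num)]
    norm_num
  have : (∫ ω, Z ω ^ 2 ∂μ) / (4 * c) ≤ 1 / 2 := by linarith
  rw [div_le_iff₀ (by positivity)] at this
  linarith

theorem IsSubGaussianVec.integral_norm_sq_le {d : ℕ} {c : NNReal} {P : Measure (Vec d)}
    [IsProbabilityMeasure P] (h : IsSubGaussianVec c P) : ∫ z, ‖z‖ ^ 2 ∂P ≤ d * (2 * c) := by
  simp_rw [EuclideanSpace.norm_sq_eq, Real.norm_eq_abs, sq_abs]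
  rw [integral_finsetSum _ fun k _ => ((h.hasSubgaussianMGF_apply k).memLp 2).integrable_sq]
  calc _ ≤ ∑ _k : Fin d, 2 * (c : ℝ) := Finset.sum_le_sum fun k _ =>
        integral_sq_le_of_hasSubgaussianMGF (by fun_prop) (h.hasSubgaussianMGF_apply k)
    _ = _ := by simp

theorem IsSubGaussianVec.measure_lt_norm_le {d : ℕ} {c : NNReal} {P : Measure (Vec d)}
    [SFinite P] (hc : 0 < c) (h : IsSubGaussianVec c P) {r : ℝ} (hr : 0 ≤ r) :
    P {z | r < ‖z‖} ≤ ENNReal.ofReal (Real.exp (d / 2 - r ^ 2 / (4 * c))) := by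
  have hc' : (0 : ℝ) < c := hc
  have hsub : {z : Vec d | r < ‖z‖} ⊆ {z | ENNReal.ofReal (Real.exp (r ^ 2 / (4 * c)))
      ≤ ENNReal.ofReal (Real.exp (‖z‖ ^ 2 / (4 * c)))} := by
    intro z hz
    have hz : r < ‖z‖ := hz
    refine ENNReal.ofReal_le_ofReal (Real.exp_le_exp.2 ?_)
    gcongr
  calc P {z | r < ‖z‖} ≤ _ := measure_mono hsub
    _ ≤ _ := meas_ge_le_lintegral_div (by fun_prop) (by positivity) ENNReal.ofReal_ne_top
    _ ≤ ENNReal.ofReal (Real.exp (d / 2)) / ENNReal.ofReal (Real.exp (r ^ 2 / (4 * c))) := by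
      gcongr
      exact (h.lintegral_exp_norm_sq_le hc).trans
        (ENNReal.ofReal_le_ofReal (sqrt_two_pow_le_exp d))
    _ = _ := by rw [← ENNReal.ofReal_div_of_pos (by positivity), ← Real.exp_sub]

theorem IsSubGaussianVec.integral_indicator_norm_sq_le {d : ℕ} {c : NNReal} {P : Measure (Vec d)}
    [SFinite P] (hc : 0 < c) (h : IsSubGaussianVec c P) {r : ℝ} (hr : 0 ≤ r) :
    ∫ z, {z : Vec d | r < ‖z‖}.indicator (fun z => ‖z‖ ^ 2) z ∂P
      ≤ 4 * c * Real.exp (d / 2 - r ^ 2 / (4 * c) / 2) := by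
  have hc' : (0 : ℝ) < c := hc
  have hexp := (h.lintegral_exp_norm_sq_le hc).trans
        (ENNReal.ofReal_le_ofReal (sqrt_two_pow_le_exp d))
  have hint : Integrable (fun z : Vec d => Real.exp (‖z‖ ^ 2 / (4 * c))) P := by
    refine ⟨by fun_prop, ?_⟩
    rw [hasFiniteIntegral_iff_ofReal (Filter.Eventually.of_forall fun ω => by positivity)]
    exact hexp.trans_lt ENNReal.ofReal_lt_top
  rw [← ofReal_integral_eq_lintegral_ofReal hint
    (Filter.Eventually.of_forall fun ω => by positivity),
    ENNReal.ofReal_le_ofReal_iff (by positivity)] at hexp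
  have hmeas : MeasurableSet {z : Vec d | r < ‖z‖} := measurableSet_lt (by fun_prop) (by fun_prop)
  calc _ ≤ ∫ z, 4 * c * Real.exp (-(r ^ 2 / (4 * c) / 2)) * Real.exp (‖z‖ ^ 2 / (4 * c)) ∂P := by
        refine integral_mono (h.integrable_norm_sq.indicator hmeas) (hint.const_mul _) fun z => ?_
        by_cases hz : z ∈ {z : Vec d | r < ‖z‖}
        swap
        · rw [Set.indicator_of_notMem hz]
          positivity
        rw [Set.indicator_of_mem hz]
        have hz : r < ‖z‖ := hz
        have h1 : r ^ 2 / (4 * c) ≤ ‖z‖ ^ 2 / (4 * c) := by gcongr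
        have h2 := Real.add_one_le_exp (‖z‖ ^ 2 / (4 * c) / 4)
        -- With y = ‖z‖²/(4c): y ≤ (1 + y/4)² ≤ exp(y/2). Beyond the radius, where y ≥ r²/(4c), half
        -- of the exponent thus absorbs the factor y and the other half yields the decay.
        have h3 : ‖z‖ ^ 2 / (4 * c) ≤ Real.exp (‖z‖ ^ 2 / (4 * c) / 2) := by
          have hy : 0 ≤ ‖z‖ ^ 2 / (4 * c) := by positivity
          rw [show ‖z‖ ^ 2 / (4 * c) / 2 = ‖z‖ ^ 2 / (4 * c) / 4 + ‖z‖ ^ 2 / (4 * c) / 4 by ring,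
            Real.exp_add]
          nlinarith [sq_nonneg (‖z‖ ^ 2 / (4 * c) - 4)]
        calc ‖z‖ ^ 2 = 4 * c * (‖z‖ ^ 2 / (4 * c)) := by field_simp
          _ ≤ 4 * c * Real.exp (‖z‖ ^ 2 / (4 * c) / 2) := by gcongr
          _ ≤ 4 * c * Real.exp (-(r ^ 2 / (4 * c) / 2) + ‖z‖ ^ 2 / (4 * c)) := by
            gcongr
            linarith
          _ = _ := by
            rw [Real.exp_add]
            ring
    _ = 4 * c * Real.exp (-(r ^ 2 / (4 * c) / 2)) * ∫ z, Real.exp (‖z‖ ^ 2 / (4 * c)) ∂P :=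
        integral_const_mul _ _
    _ ≤ 4 * c * Real.exp (-(r ^ 2 / (4 * c) / 2)) * Real.exp (d / 2) := by gcongr
    _ = _ := by
        rw [mul_assoc, ← Real.exp_add]
        congr 2
        ring

/-! ### Lower tails of sums of nonnegative variables. -/

/-- Invert exp x ≥ 1 + x + x²/2 and use (1 + x²/2)² - x² = 1 + x⁴/4 ≥ 1. -/
theorem exp_neg_le_one_sub_add_sq {x : ℝ} (hx : 0 ≤ x) : Real.exp (-x) ≤ 1 - x + x ^ 2 / 2 := by
  have h := Real.quadratic_le_exp_of_nonneg hx
  rw [Real.exp_neg, inv_le_comm₀ (Real.exp_pos _) (by nlinarith [sq_nonneg (x - 1)])]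
  refine le_trans ?_ h
  rw [inv_le_iff_one_le_mul₀ (by nlinarith [sq_nonneg (x - 1)])]
  nlinarith [pow_nonneg hx 4]

theorem mgf_neg_le_of_nonneg {E : Type*} [MeasurableSpace E] {D : Measure E}
    [IsProbabilityMeasure D] {Y : E → ℝ} (hY0 : ∀ z, 0 ≤ Y z) (hY : Integrable Y D)
    (hY2 : Integrable (fun z => Y z ^ 2) D) {s : ℝ} (hs : 0 ≤ s) :
    mgf Y D (-s) ≤ Real.exp (-s * ∫ z, Y z ∂D + s ^ 2 / 2 * ∫ z, Y z ^ 2 ∂D) := by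
  have hle : mgf Y D (-s) ≤ ∫ z, (1 - s * Y z + s ^ 2 / 2 * Y z ^ 2) ∂D := by
    refine integral_mono_of_nonneg (Filter.Eventually.of_forall fun z => by positivity)
      (((integrable_const _).sub (hY.const_mul _)).add (hY2.const_mul _))
      (Filter.Eventually.of_forall fun z => ?_)
    have := exp_neg_le_one_sub_add_sq (mul_nonneg hs (hY0 z))
    calc Real.exp (-s * Y z) = Real.exp (-(s * Y z)) := by rw [neg_mul]
      _ ≤ _ := this
      _ = _ := by ring
  have hadd := integral_add (f := fun z => 1 - s * Y z)
    ((integrable_const _).sub (hY.const_mul _)) (hY2.const_mul (s ^ 2 / 2))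
  rw [hadd, integral_sub (integrable_const _) (hY.const_mul _), integral_const_mul,
    integral_const_mul] at hle
  simp only [integral_const, probReal_univ, smul_eq_mul, mul_one] at hle
  refine hle.trans ?_
  have := Real.add_one_le_exp (-s * ∫ z, Y z ∂D + s ^ 2 / 2 * ∫ z, Y z ^ 2 ∂D)
  linarith

/-- Chernoff bound for the lower tail. Nonnegativity replaces boundedness: the moment generating
function at -s is controlled by two moments alone. -/
theorem measureReal_sum_le_le_exp {Ω E ι : Type*} [MeasurableSpace Ω] [MeasurableSpace E]
    [Fintype ι] {μ : Measure Ω} [IsProbabilityMeasure μ] {D : Measure E} [IsProbabilityMeasure D]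
    {X : ι → Ω → E} (hX : ∀ i, Measurable (X i)) (hind : iIndepFun X μ)
    (hlaw : ∀ i, μ.map (X i) = D) {Y : ι → E → ℝ} (hYm : ∀ i, Measurable (Y i))
    (hY0 : ∀ i z, 0 ≤ Y i z) (hY : ∀ i, Integrable (Y i) D)
    (hY2 : ∀ i, Integrable (fun z => Y i z ^ 2) D) {C ℓ : ℝ} (hC : 1 < C) (hℓ : 0 ≤ ℓ)
    (hS : 0 < ∑ i, ∫ z, Y i z ∂D)
    (hV : (∑ i, ∫ z, Y i z ^ 2 ∂D) * (2 * C ^ 2 / (C - 1) ^ 2 * ℓ) ≤ (∑ i, ∫ z, Y i z ∂D) ^ 2) :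
    μ.real {ω | C * ∑ i, Y i (X i ω) ≤ ∑ i, ∫ z, Y i z ∂D} ≤ Real.exp (-ℓ) := by
  set S := ∑ i, ∫ z, Y i z ∂D with hSdef
  set W := ∑ i, ∫ z, Y i z ^ 2 ∂D with hWdef
  have hC0 : 0 < C := by linarith
  have hC1 : 0 < C - 1 := by linarith
  -- This s minimizes the exponent -s S (C - 1)/C + s² W/2 for the largest W allowed by `hV`. The
  -- linear part is then -2ℓ and the quadratic part at most ℓ.
  set s : ℝ := (C - 1) / C * (2 * C ^ 2 / (C - 1) ^ 2 * ℓ) / S with hs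
  have hs0 : 0 ≤ s := by positivity
  have hmgf : mgf (∑ i, fun ω => Y i (X i ω)) μ (-s) ≤ Real.exp (-s * S + s ^ 2 / 2 * W) := by
    have hprod := (hind.comp Y hYm).mgf_sum (t := -s) (fun i => (hYm i).comp (hX i)) Finset.univ
    simp only [Function.comp_def] at hprod
    rw [hprod, hSdef, hWdef,
      Finset.mul_sum, Finset.mul_sum, ← Finset.sum_add_distrib, Real.exp_sum]
    refine Finset.prod_le_prod (fun i _ => mgf_nonneg) fun i _ => ?_
    have : mgf (fun ω => Y i (X i ω)) μ (-s) = mgf (Y i) D (-s) := by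
      rw [← hlaw i, mgf_map (hX i).aemeasurable, Function.comp_def]
      have := hYm i
      fun_prop
    rw [this]
    exact mgf_neg_le_of_nonneg (hY0 i) (hY i) (hY2 i) hs0
  have hint : Integrable (fun ω => Real.exp (-s * (∑ i, fun ω => Y i (X i ω)) ω)) μ := by
    refine Integrable.of_bound (C := 1) ?_ (Filter.Eventually.of_forall fun ω => ?_)
    · simp only [Finset.sum_apply]
      exact (((Finset.measurable_sum _ fun i _ => (hYm i).comp (hX i)).const_mul
        (-s)).exp).aestronglyMeasurable
    · rw [Real.norm_eq_abs, Real.abs_exp, Real.exp_le_one_iff, Finset.sum_apply]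
      have := Finset.sum_nonneg fun i (_ : i ∈ Finset.univ) => hY0 i (X i ω)
      nlinarith
  have hch := measure_le_le_exp_mul_mgf (μ := μ) (X := ∑ i, fun ω => Y i (X i ω)) (S / C)
    (neg_nonpos.2 hs0) hint
  have hset : {ω | C * ∑ i, Y i (X i ω) ≤ S}
      = {ω | (∑ i, fun ω => Y i (X i ω)) ω ≤ S / C} := by
    ext ω
    simp only [Set.mem_ofPred_eq, Finset.sum_apply]
    rw [le_div_iff₀ hC0, mul_comm]
  rw [hset]
  refine hch.trans ((mul_le_mul_of_nonneg_left hmgf (Real.exp_pos _).le).trans ?_)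
  rw [← Real.exp_add, Real.exp_le_exp]
  have hβ : s * S = (C - 1) / C * (2 * C ^ 2 / (C - 1) ^ 2 * ℓ) := by
    rw [hs]
    field_simp
  have h1 : - -s * (S / C) + (-s * S) = -(2 * ℓ) := by
    have : - -s * (S / C) + (-s * S) = -((C - 1) / C * (s * S)) := by
      field_simp
      ring
    rw [this, hβ]
    field_simp
  have h2 : s ^ 2 / 2 * W ≤ ℓ := by
    have hs2 : s ^ 2 * W = (2 * ℓ) * (W * (2 * C ^ 2 / (C - 1) ^ 2 * ℓ)) / S ^ 2 := by
      rw [hs]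
      field_simp
    have : s ^ 2 * W ≤ 2 * ℓ := by
      rw [hs2, div_le_iff₀ (by positivity)]
      gcongr
    linarith
  linarith

/-! ### Noise with a quadratic offset. -/

/-- The noise contributes 8 s² c_j² ν² ‖y_j‖² to the exponent, which the offset s c_j ‖y_j‖²
dominates once 8 s c_j ν² ≤ 1. The condition does not involve the vectors y_j, so the resulting
bound is free of the size of the differences of predictors. -/
theorem lintegral_exp_offset_le_one {ι : Type*} [Fintype ι] {d : ℕ} {ν : NNReal}
    {Q : Measure (ι → Vec d)} [IsProbabilityMeasure Q]
    (hind : iIndepFun (fun (j : ι) (v : ι → Vec d) => v j) Q)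
    (hsub : ∀ j, IsSubGaussianVec (ν ^ 2) (Q.map fun v => v j))
    {c : ι → ℝ} {A s : ℝ} (hc0 : ∀ j, 0 ≤ c j) (hcA : ∀ j, c j ≤ A) (hs : 0 ≤ s)
    (hsA : 8 * s * A * (ν : ℝ) ^ 2 ≤ 1) (y : ι → Vec d) :
    ∫⁻ v, ENNReal.ofReal (Real.exp (s * (4 * ∑ j, c j * inner ℝ (y j) (v j)
      - ∑ j, c j * ‖y j‖ ^ 2))) ∂Q ≤ 1 := by
  have hmap : ∀ j, IsProbabilityMeasure (Q.map fun v => v j) := fun j =>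
    Measure.isProbabilityMeasure_map (measurable_pi_apply j).aemeasurable
  have hone : ∀ j, HasSubgaussianMGF (fun v : ι → Vec d => inner ℝ ((4 * c j) • y j) (v j))
      (‖(4 * c j) • y j‖₊ ^ 2 * ν ^ 2) Q := fun j =>
    HasSubgaussianMGF.of_map (Y := fun v : ι → Vec d => v j) (measurable_pi_apply j).aemeasurable
      ((hsub j).hasSubgaussianMGF_inner ((4 * c j) • y j))
  have hind' : iIndepFun (fun (j : ι) (v : ι → Vec d) => inner ℝ ((4 * c j) • y j) (v j)) Q :=
    hind.comp (fun j x => inner ℝ ((4 * c j) • y j) x) fun j => by fun_prop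
  have hsum := HasSubgaussianMGF.sum_of_iIndepFun hind' (s := Finset.univ) fun j _ => hone j
  have hrw : ∀ v : ι → Vec d, Real.exp (s * (4 * ∑ j, c j * inner ℝ (y j) (v j)
      - ∑ j, c j * ‖y j‖ ^ 2)) = Real.exp (-(s * ∑ j, c j * ‖y j‖ ^ 2)) *
        Real.exp (s * ∑ j, inner ℝ ((4 * c j) • y j) (v j)) := by
    intro v
    rw [← Real.exp_add]
    congr 1
    simp_rw [real_inner_smul_left, mul_assoc, ← Finset.mul_sum]
    ring
  simp_rw [hrw]
  rw [← ofReal_integral_eq_lintegral_ofReal ((hsum.integrable_exp_mul s).const_mul _)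
    (Filter.Eventually.of_forall fun v => by positivity), integral_const_mul]
  rw [← ENNReal.ofReal_one]
  refine ENNReal.ofReal_le_ofReal ?_
  refine (mul_le_mul_of_nonneg_left (hsum.mgf_le s) (Real.exp_pos _).le).trans ?_
  rw [← Real.exp_add, Real.exp_le_one_iff]
  push_cast
  have : (∑ j, ‖(4 * c j) • y j‖ ^ 2 * (ν : ℝ) ^ 2) * s ^ 2 / 2
      ≤ s * ∑ j, c j * ‖y j‖ ^ 2 := by
    rw [Finset.sum_mul, Finset.sum_div, Finset.mul_sum]
    refine Finset.sum_le_sum fun j _ => ?_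
    rw [norm_smul, mul_pow, Real.norm_eq_abs, sq_abs]
    have h1 : 8 * s * c j * (ν : ℝ) ^ 2 ≤ 1 := by
      refine le_trans ?_ hsA
      have := hcA j
      gcongr
    have h2 : 0 ≤ s * (c j * ‖y j‖ ^ 2) :=
      mul_nonneg hs (mul_nonneg (hc0 j) (by positivity))
    calc _ = (8 * s * c j * (ν : ℝ) ^ 2) * (s * (c j * ‖y j‖ ^ 2)) := by ring
      _ ≤ 1 * (s * (c j * ‖y j‖ ^ 2)) := by gcongr
      _ = _ := one_mul _
  linarith

/-! ### Measurability, and the objective as a weighted sum over samples. -/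

theorem measurable_traj {d T : ℕ} {g : (t : ℕ) → (Fin t → Vec d) → Vec d}
    (hg : ∀ t, 0 < t → t < T → Measurable (g t)) :
    ∀ t, t < T → Measurable fun z => traj g z t := by
  intro t
  induction t using Nat.strong_induction_on with
  | _ t ih =>
    intro ht
    cases t with
    | zero =>
      simp only [traj]
      exact measurable_id
    | succ t =>
      simp only [traj]
      exact (hg (t + 1) t.succ_pos ht).comp
        (measurable_pi_lambda _ fun s => ih s.val s.isLt (s.isLt.trans ht))

namespace ReplayModel

variable {dx dy p T m : ℕ} (P : ReplayModel dx dy p T m)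

theorem measurable_x (hreg : P.Regular) (t : Fin T) : Measurable (P.x t) :=
  measurable_traj hreg.meas_g t.val t.isLt

theorem measurable_G (hreg : P.Regular) (hΘ : P.BoundedRealizable) {θ : Vec p} (hθ : θ ∈ P.Θ)
    (t : Fin T) : Measurable (P.G θ t) :=
  ((hreg.meas_f θ hθ).comp (P.measurable_x hreg t)).sub
    ((hreg.meas_f _ hΘ.2).comp (P.measurable_x hreg t))

theorem G_eq_zero {θ : Vec p} (h : P.f θ = P.f P.θstar) (t : Fin T) (z : Vec dx) :
    P.G θ t z = 0 := by
  rw [G, h, sub_self]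

theorem m2_nonneg (θ : Vec p) (t : Fin T) : 0 ≤ P.m2 θ t :=
  integral_nonneg fun _ => by positivity

theorem m2_eq_zero {θ : Vec p} (h : P.f θ = P.f P.θstar) (t : Fin T) : P.m2 θ t = 0 := by
  simp [m2, P.G_eq_zero h]

theorem err_eq (θ : Vec p) : P.err θ = 1 / (T : ℝ) * ∑ t, P.w t * P.m2 θ t := by
  rw [err]
  simp_rw [m2, G, norm_sub_rev]

/-- Weight of sample `i` of task `t` in the objective. -/
noncomputable def coef (j : Fin T × Fin m) : ℝ := if j.2 ∈ P.R j.1 then P.w j.1 / P.n j.1 else 0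

/-- Indices of the stored samples of all tasks. -/
noncomputable def stored : Finset (Fin T × Fin m) := Finset.univ.filter fun j => j.2 ∈ P.R j.1

theorem sum_stored (F : Fin T × Fin m → ℝ) :
    ∑ j ∈ P.stored, F j = ∑ t, ∑ i ∈ P.R t, F (t, i) := by
  rw [stored, Finset.sum_filter, Fintype.sum_prod_type]
  simp

theorem card_stored : P.stored.card = P.total := by
  rw [stored, Finset.card_filter, Fintype.sum_prod_type]
  simp [total, n]

theorem sum_coef_mul (F : Fin T × Fin m → ℝ) :
    ∑ j, P.coef j * F j = ∑ t, ∑ i ∈ P.R t, P.w t / P.n t * F (t, i) := by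
  rw [← P.sum_stored fun j => P.w j.1 / P.n j.1 * F j, stored, Finset.sum_filter]
  simp only [coef, ite_mul, zero_mul]

/-- A task of positive weight without stored samples would be lost on the left, where all its
coefficients vanish. -/
theorem sum_coef_mul_fst (hn : ∀ t, 0 < P.w t → P.n t ≠ 0) (hw : ∀ t, 0 ≤ P.w t)
    (F : Fin T → ℝ) : ∑ j, P.coef j * F j.1 = ∑ t, P.w t * F t := by
  rw [P.sum_coef_mul fun j => F j.1]
  refine Finset.sum_congr rfl fun t _ => ?_
  simp only [Finset.sum_const, nsmul_eq_mul]
  rcases (hw t).eq_or_lt with h | h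
  · simp [← h]
  · have : (P.n t : ℝ) ≠ 0 := Nat.cast_ne_zero.2 (hn t h)
    rw [← mul_assoc]
    congr 1
    exact mul_div_cancel₀ _ this

theorem coef_nonneg (hreg : P.Regular) (j : Fin T × Fin m) : 0 ≤ P.coef j := by
  rw [coef]
  split_ifs
  · exact div_nonneg (hreg.w_nonneg _) (Nat.cast_nonneg _)
  · exact le_rfl

theorem maxRatio_nonneg (hreg : P.Regular) : 0 ≤ P.maxRatio :=
  Real.iSup_nonneg fun t => div_nonneg (hreg.w_nonneg t) (Nat.cast_nonneg _)

theorem ratio_le_maxRatio (t : Fin T) : P.w t / P.n t ≤ P.maxRatio :=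
  le_ciSup (f := fun t : Fin T => P.w t / (P.n t : ℝ)) (Set.finite_range _).bddAbove t

theorem coef_le_maxRatio (hreg : P.Regular) (j : Fin T × Fin m) : P.coef j ≤ P.maxRatio := by
  rw [coef]
  split_ifs
  · exact P.ratio_le_maxRatio j.1
  · exact P.maxRatio_nonneg hreg

/-- Weighted empirical error of the inputs `ξ`. -/
noncomputable def empErr (ξ : Fin m → Vec dx) (θ : Vec p) : ℝ :=
  ∑ j, P.coef j * ‖P.G θ j.1 (ξ j.2)‖ ^ 2

/-- Weighted correlation of the noise with the differences of predictors. -/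
noncomputable def noiseCorr (ξ : Fin m → Vec dx) (v : Fin T × Fin m → Vec dy) (θ : Vec p) : ℝ :=
  ∑ j, P.coef j * inner ℝ (P.G θ j.1 (ξ j.2)) (v j)

theorem objective_eq (ξ : Fin m → Vec dx) (v : Fin T × Fin m → Vec dy) (θ : Vec p) :
    P.objective ξ v θ = 1 / (T : ℝ) * (P.empErr ξ θ - 2 * P.noiseCorr ξ v θ
      + ∑ j, P.coef j * ‖v j‖ ^ 2) + P.lam * P.reg θ := by
  have h : P.empErr ξ θ - 2 * P.noiseCorr ξ v θ + ∑ j, P.coef j * ‖v j‖ ^ 2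
      = ∑ j, P.coef j * ‖P.G θ j.1 (ξ j.2) - v j‖ ^ 2 := by
    rw [empErr, noiseCorr, Finset.mul_sum, ← Finset.sum_sub_distrib, ← Finset.sum_add_distrib]
    refine Finset.sum_congr rfl fun j _ => ?_
    rw [norm_sub_sq_real]
    ring
  rw [h, P.sum_coef_mul fun j => ‖P.G θ j.1 (ξ j.2) - v j‖ ^ 2, objective]
  simp only [G, sub_sub]

/-- Minimality against `θstar` gives `empErr ≤ 2 noiseCorr + T λ Ω(θ*)`. It is doubled, and one copy
of `empErr` is moved to the right to serve as the offset. -/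
theorem empErr_le_of_isMinOn (hT : 0 < T) (hreg : P.Regular) (hΘ : P.BoundedRealizable)
    {ξ : Fin m → Vec dx} {v : Fin T × Fin m → Vec dy} {θ : Vec p} (hθ : θ ∈ P.Θ)
    (hmin : IsMinOn (P.objective ξ v) P.Θ θ) :
    P.empErr ξ θ ≤ 4 * P.noiseCorr ξ v θ - P.empErr ξ θ + 2 * (T * P.lam * P.reg P.θstar) := by
  have hT' : (0 : ℝ) < T := Nat.cast_pos.2 hT
  have h := hmin hΘ.2
  simp only [Set.mem_ofPred_eq] at h
  rw [P.objective_eq, P.objective_eq] at h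
  have h0 : P.empErr ξ P.θstar = 0 := by simp [empErr, P.G_eq_zero rfl]
  have h1 : P.noiseCorr ξ v P.θstar = 0 := by simp [noiseCorr, P.G_eq_zero rfl]
  rw [h0, h1] at h
  have h2 : 0 ≤ P.lam * P.reg θ := mul_nonneg hreg.lam_nonneg (hreg.reg_nonneg _ hθ)
  have h3 : 1 / (T : ℝ) * (P.empErr ξ θ - 2 * P.noiseCorr ξ v θ)
      ≤ P.lam * P.reg P.θstar := by linarith
  rw [one_div_mul_eq_div, div_le_iff₀ hT'] at h3
  linarith

/-! ### Calibration of the input radius. -/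

section Radius

variable {P} {LG kG α σ δ : ℝ}

theorem one_le_four_mul_div (hm : 0 < m) (hδ : 0 < δ) (hδ1 : δ ≤ 1) : 1 ≤ 4 * (m : ℝ) / δ := by
  have : (1 : ℝ) ≤ m := Nat.one_le_cast.2 hm
  rw [le_div_iff₀ hδ]
  linarith

theorem le_tailFactor (hσ : 0 ≤ σ) (hLG : 0 < LG) (hkG : 0 < kG) (hδ : 0 < δ) :
    4 * (m : ℝ) / δ ≤ P.tailFactor LG kG α σ δ := by
  rw [tailFactor]
  have : 0 ≤ σ ^ α := Real.rpow_nonneg hσ α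
  refine le_mul_of_one_le_right (by positivity) ?_
  have : 0 ≤ 64 * P.total * (LG * σ) * (LG * σ + √P.M2) / (kG * σ ^ α) := by positivity
  linarith

theorem mul_le_tailFactor_mul (hσ : 0 < σ) (hLG : 0 < LG) (hkG : 0 < kG)
    (hm : 0 < m) (hδ : 0 < δ) (hδ1 : δ ≤ 1) :
    64 * P.total * (LG * σ) * (LG * σ + √P.M2)
      ≤ P.tailFactor LG kG α σ δ * (kG * σ ^ α) := by
  have hpos : 0 < kG * σ ^ α := mul_pos hkG (Real.rpow_pos_of_pos hσ α)
  rw [← div_le_iff₀ hpos, tailFactor]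
  have h0 : 0 ≤ 64 * P.total * (LG * σ) * (LG * σ + √P.M2) / (kG * σ ^ α) := by positivity
  nlinarith [one_le_four_mul_div hm hδ hδ1]

theorem three_mul_le_inputRadius (hσ : 0 ≤ σ) : 3 * σ ≤ P.inputRadius LG kG α σ δ := by
  rw [inputRadius]
  have := Real.sqrt_nonneg (Real.log (P.tailFactor LG kG α σ δ) / dx)
  nlinarith

theorem inputRadius_nonneg (hσ : 0 ≤ σ) : 0 ≤ P.inputRadius LG kG α σ δ := by
  linarith [three_mul_le_inputRadius (P := P) (LG := LG) (kG := kG) (α := α) (δ := δ) hσ]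

theorem rpow_le_inputRadius_rpow (hσ : 0 ≤ σ) (hα : 0 < α) :
    σ ^ α ≤ P.inputRadius LG kG α σ δ ^ α := by
  refine Real.rpow_le_rpow hσ ?_ hα.le
  linarith [three_mul_le_inputRadius (P := P) (LG := LG) (kG := kG) (α := α) (δ := δ) hσ]

/-- Both terms carry a factor 2 because the truncated second moment decays with only half of this
exponent; the half still beats the dimensional factor exp(dx/2) and leaves 1/Λ. -/
theorem le_inputRadius_sq_div (hσ : 0 < σ) (hdx : 0 < dx) (hLG : 0 < LG) (hkG : 0 < kG)
    (hm : 0 < m) (hδ : 0 < δ) (hδ1 : δ ≤ 1) :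
    2 * (dx : ℝ) + 2 * Real.log (P.tailFactor LG kG α σ δ)
      ≤ P.inputRadius LG kG α σ δ ^ 2 / (4 * (σ ^ 2 / dx)) := by
  have hd : (0 : ℝ) < dx := Nat.cast_pos.2 hdx
  have hlog : 0 ≤ Real.log (P.tailFactor LG kG α σ δ) :=
    Real.log_nonneg ((one_le_four_mul_div hm hδ hδ1).trans (le_tailFactor hσ.le hLG hkG hδ))
  rw [inputRadius]
  set u := Real.log (P.tailFactor LG kG α σ δ) with hu
  have hs := Real.sqrt_nonneg (u / dx)
  have hs2 := Real.sq_sqrt (div_nonneg hlog hd.le)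
  have : (σ * (3 + 16 * √(u / dx))) ^ 2 / (4 * (σ ^ 2 / dx))
      = (9 + 96 * √(u / dx) + 256 * √(u / dx) ^ 2) * dx / 4 := by
    field_simp
    ring
  rw [this, hs2]
  have h2 : (9 + 96 * √(u / dx) + 256 * (u / dx)) * dx / 4
      = 9 * dx / 4 + 24 * (√(u / dx) * dx) + 64 * u := by
    field_simp
    ring
  rw [h2]
  have := mul_nonneg hs hd.le
  linarith

end Radius

/-! ### Second moments of the difference maps. -/

section Moments

variable {P} {LF LG kG α q δ : ℝ} {σ : NNReal}

theorem norm_G_sq_le {LG : ℝ} {θ : Vec p} {t : Fin T}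
    (h : ∀ z z', ‖P.G θ t z - P.G θ t z'‖ ≤ LG * ‖z - z'‖) (z z' : Vec dx) :
    ‖P.G θ t z‖ ^ 2 ≤ 2 * ‖P.G θ t z'‖ ^ 2 + 2 * LG ^ 2 * ‖z - z'‖ ^ 2 := by
  have h1 : ‖P.G θ t z‖ ≤ ‖P.G θ t z'‖ + LG * ‖z - z'‖ := by
    have := norm_add_le (P.G θ t z') (P.G θ t z - P.G θ t z')
    rw [add_sub_cancel] at this
    linarith [h z z']
  calc ‖P.G θ t z‖ ^ 2 ≤ (‖P.G θ t z'‖ + LG * ‖z - z'‖) ^ 2 := by gcongr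
    _ ≤ _ := by nlinarith [sq_nonneg (‖P.G θ t z'‖ - LG * ‖z - z'‖)]

theorem integrable_norm_G_sq (hreg : P.Regular) (hΘ : P.BoundedRealizable) {c : NNReal}
    (hinput : IsSubGaussianVec c P.D) {θ : Vec p} (hθ : θ ∈ P.Θ) {t : Fin T}
    (h : ∀ z z', ‖P.G θ t z - P.G θ t z'‖ ≤ LG * ‖z - z'‖) :
    Integrable (fun z => ‖P.G θ t z‖ ^ 2) P.D := by
  have := hreg.prob
  refine Integrable.mono' (g := fun z => 2 * ‖P.G θ t 0‖ ^ 2 + 2 * LG ^ 2 * ‖z‖ ^ 2)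
    ((integrable_const _).add (hinput.integrable_norm_sq.const_mul _))
    ((P.measurable_G hreg hΘ hθ t).norm.pow_const 2).aestronglyMeasurable
    (Filter.Eventually.of_forall fun z => ?_)
  rw [Real.norm_of_nonneg (by positivity)]
  simpa using norm_G_sq_le h z 0

theorem integral_norm_sq_input_le (hreg : P.Regular) (hdx : 0 < dx)
    (hinput : IsSubGaussianVec (σ ^ 2 / (dx : NNReal)) P.D) :
    ∫ z, ‖z‖ ^ 2 ∂P.D ≤ 2 * (σ : ℝ) ^ 2 := by
  have := hreg.prob
  have hd : (0 : ℝ) < dx := Nat.cast_pos.2 hdx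
  refine hinput.integral_norm_sq_le.trans_eq ?_
  push_cast
  field_simp

/-- `M2` is a real `sSup`, meaningful only for a bounded set. At z = 0 the map is controlled by the
boundedness of Θ, elsewhere by its Lipschitz constant. -/
theorem bddAbove_m2 (hreg : P.Regular) (hΘ : P.BoundedRealizable) (hdx : 0 < dx) (hkG : 0 < kG)
    (hinput : IsSubGaussianVec (σ ^ 2 / (dx : NNReal)) P.D) (hLF : 0 < LF)
    {r : ℝ} (hr : 0 ≤ r) (hlip : P.LipschitzConditions q LF LG r (kG * r ^ α)) :
    BddAbove {a | ∃ θ ∈ P.Θ, ∃ t : Fin T, 0 < P.w t ∧ a = P.m2 θ t} := by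
  have := hreg.prob
  refine ⟨2 * (kG * r ^ α * (LF * Metric.diam P.Θ)) + 2 * LG ^ 2 * (2 * σ ^ 2), ?_⟩
  rintro a ⟨θ, hθ, t, -, rfl⟩
  have hK : 0 ≤ kG * r ^ α := mul_nonneg hkG.le (Real.rpow_nonneg hr α)
  have h0 : ‖P.G θ t 0‖ ^ 2 ≤ kG * r ^ α * (LF * Metric.diam P.Θ) := by
    have h := hlip.ball_sq θ hθ P.θstar hΘ.2 t 0 (by simpa using hr)
    rw [P.G_eq_zero (θ := P.θstar) rfl, norm_zero] at h
    calc ‖P.G θ t 0‖ ^ 2 ≤ |‖P.G θ t 0‖ ^ 2 - 0 ^ 2| := by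
          rw [show (0 : ℝ) ^ 2 = 0 by norm_num, sub_zero]
          exact le_abs_self _
      _ ≤ _ := h
      _ ≤ _ := by
        gcongr
        refine (hlip.class_lipschitz θ hθ _ hΘ.2).trans ?_
        gcongr
        rw [← dist_eq_norm]
        exact Metric.dist_le_diam_of_mem hΘ.1 hθ hΘ.2
  calc P.m2 θ t ≤ ∫ z, (2 * ‖P.G θ t 0‖ ^ 2 + 2 * LG ^ 2 * ‖z‖ ^ 2) ∂P.D := by
        refine integral_mono (integrable_norm_G_sq hreg hΘ hinput hθ (hlip.G_lipschitz θ hθ t))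
          ((integrable_const _).add (hinput.integrable_norm_sq.const_mul _)) fun z => ?_
        simpa using norm_G_sq_le (hlip.G_lipschitz θ hθ t) z 0
    _ = 2 * ‖P.G θ t 0‖ ^ 2 + 2 * LG ^ 2 * ∫ z, ‖z‖ ^ 2 ∂P.D := by
        rw [integral_add (integrable_const _) (hinput.integrable_norm_sq.const_mul _),
          integral_const_mul (2 * LG ^ 2)]
        simp
    _ ≤ _ := by
        have := integral_norm_sq_input_le hreg hdx hinput
        gcongr

/-- Compare the value at 0 with the value at z by the Lipschitz bound, and average over z. -/
theorem norm_G_zero_le (hreg : P.Regular) (hΘ : P.BoundedRealizable) (hdx : 0 < dx)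
    (hinput : IsSubGaussianVec (σ ^ 2 / (dx : NNReal)) P.D) (hLG : 0 < LG) {θ : Vec p}
    (hθ : θ ∈ P.Θ) {t : Fin T} (h : ∀ z z', ‖P.G θ t z - P.G θ t z'‖ ≤ LG * ‖z - z'‖)
    (hM : P.m2 θ t ≤ P.M2) : ‖P.G θ t 0‖ ≤ 2 * (LG * σ + √P.M2) := by
  have := hreg.prob
  have hint := integrable_norm_G_sq hreg hΘ hinput hθ h
  have h1 : ‖P.G θ t 0‖ ^ 2 ≤ 2 * P.m2 θ t + 2 * LG ^ 2 * ∫ z, ‖z‖ ^ 2 ∂P.D := by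
    have : ∫ _z : Vec dx, ‖P.G θ t 0‖ ^ 2 ∂P.D
        ≤ ∫ z, (2 * ‖P.G θ t z‖ ^ 2 + 2 * LG ^ 2 * ‖z‖ ^ 2) ∂P.D :=
      integral_mono (integrable_const _)
        ((hint.const_mul _).add (hinput.integrable_norm_sq.const_mul _))
        fun z => by simpa using norm_G_sq_le h 0 z
    rw [integral_add (hint.const_mul _) (hinput.integrable_norm_sq.const_mul _),
      integral_const_mul, integral_const_mul] at this
    simpa [m2] using this
  have h2 := integral_norm_sq_input_le hreg hdx hinput
  have hM0 : 0 ≤ P.M2 := (P.m2_nonneg θ t).trans hM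
  have h3 : ‖P.G θ t 0‖ ^ 2 ≤ (2 * (LG * σ + √P.M2)) ^ 2 := by
    calc ‖P.G θ t 0‖ ^ 2 ≤ 2 * P.M2 + 2 * LG ^ 2 * (2 * (σ : ℝ) ^ 2) := by
          refine h1.trans ?_
          gcongr
      _ ≤ _ := by
          have hs := Real.sq_sqrt hM0
          have : 0 ≤ LG * σ * √P.M2 := by positivity
          nlinarith
  exact le_of_sq_le_sq h3 (by positivity)

end Moments
end ReplayModel

/-! ### Passage to a nearby parameter, inside and outside the ball. -/

namespace ReplayModel

variable {dx dy p T m : ℕ} {P : ReplayModel dx dy p T m}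
variable {LF LG kG α q C ℓ δ : ℝ} {σ : NNReal}

theorem norm_G_sq_sub_le {LG : ℝ} (hLG : 0 ≤ LG) {θ : Vec p} {t : Fin T}
    (h : ∀ z z', ‖P.G θ t z - P.G θ t z'‖ ≤ LG * ‖z - z'‖) (z : Vec dx) :
    |‖P.G θ t z‖ ^ 2 - ‖P.G θ t 0‖ ^ 2| ≤ LG * ‖z‖ * (2 * ‖P.G θ t 0‖ + LG * ‖z‖) := by
  have h1 : |‖P.G θ t z‖ - ‖P.G θ t 0‖| ≤ LG * ‖z‖ := by
    simpa using (abs_norm_sub_norm_le _ _).trans (h z 0)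
  have h2 : ‖P.G θ t z‖ + ‖P.G θ t 0‖ ≤ 2 * ‖P.G θ t 0‖ + LG * ‖z‖ := by
    linarith [(abs_le.1 h1).2]
  rw [show ‖P.G θ t z‖ ^ 2 - ‖P.G θ t 0‖ ^ 2
    = (‖P.G θ t z‖ - ‖P.G θ t 0‖) * (‖P.G θ t z‖ + ‖P.G θ t 0‖) by ring, abs_mul,
    abs_of_nonneg (add_nonneg (norm_nonneg (P.G θ t z)) (norm_nonneg (P.G θ t 0)))]
  gcongr

theorem measure_inputRadius_lt_le (hreg : P.Regular) (hdx : 0 < dx) (hm : 0 < m)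
    (hinput : IsSubGaussianVec (σ ^ 2 / (dx : NNReal)) P.D) (hLG : 0 < LG) (hkG : 0 < kG)
    (hδ : 0 < δ) (hδ1 : δ ≤ 1) :
    P.D {z | P.inputRadius LG kG α σ δ < ‖z‖} ≤ ENNReal.ofReal (δ / (4 * m)) := by
  have := hreg.prob
  have hd : (0 : ℝ) < dx := Nat.cast_pos.2 hdx
  have hm' : (0 : ℝ) < m := Nat.cast_pos.2 hm
  rcases eq_or_ne σ 0 with rfl | hσ
  · have h0 : ∀ᵐ z ∂P.D, z = 0 := by
      refine IsSubGaussianVec.ae_eq_zero ?_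
      simpa using hinput
    have : P.D {z | P.inputRadius LG kG α ((0 : NNReal) : ℝ) δ < ‖z‖} = 0 := by
      have hsub : {z : Vec dx | P.inputRadius LG kG α ((0 : NNReal) : ℝ) δ < ‖z‖}
          ⊆ {z | ¬z = 0} := by
        intro z hz hz0
        rw [Set.mem_ofPred_eq, hz0, norm_zero] at hz
        exact absurd hz (not_lt.2 (inputRadius_nonneg le_rfl))
      exact measure_mono_null hsub (ae_iff.1 h0)
    rw [this]
    exact zero_le
  · have hσ0 : 0 < σ := pos_iff_ne_zero.2 hσ
    have hσ' : (0 : ℝ) < σ := hσ0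
    have hdN : (0 : NNReal) < dx := Nat.cast_pos.2 hdx
    refine (hinput.measure_lt_norm_le (by positivity) (inputRadius_nonneg hσ'.le)).trans ?_
    refine ENNReal.ofReal_le_ofReal ?_
    have h1 := le_inputRadius_sq_div (P := P) (α := α) hσ' hdx hLG hkG hm hδ hδ1
    have h2 := le_tailFactor (P := P) (α := α) hσ'.le hLG hkG hδ
    have h3 := one_le_four_mul_div hm hδ hδ1
    have hlog := Real.log_nonneg h3
    have hlog2 := Real.log_le_log (by positivity) h2
    push_cast
    calc _ ≤ Real.exp (-Real.log (4 * m / δ)) := Real.exp_le_exp.2 (by linarith)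
      _ = δ / (4 * m) := by
        rw [Real.exp_neg, Real.exp_log (by positivity), inv_div]

/-- Closeness of the two maps is known only on the ball. Outside it, both are compared with their
values at 0, and their growth is at most a multiple of ‖z‖², whose truncated integral is at most
4σ²/Λ. -/
theorem total_mul_m2_le (hreg : P.Regular) (hΘ : P.BoundedRealizable) (hdx : 0 < dx) (hm : 0 < m)
    (hinput : IsSubGaussianVec (σ ^ 2 / (dx : NNReal)) P.D) (hLF : 0 < LF) (hLG : 0 < LG)
    (hkG : 0 < kG) (hα : 0 < α) (hδ : 0 < δ) (hδ1 : δ ≤ 1)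
    (hlip : P.LipschitzConditions q LF LG (P.inputRadius LG kG α σ δ)
      (kG * P.inputRadius LG kG α σ δ ^ α))
    {θ θ' : Vec p} (hθ : θ ∈ P.Θ) (hθ' : θ' ∈ P.Θ) {t : Fin T} (ht : 0 < P.w t) {Δ : ℝ}
    (hΔ : ∀ z, ‖z‖ ≤ P.inputRadius LG kG α σ δ →
      |‖P.G θ t z‖ ^ 2 - ‖P.G θ' t z‖ ^ 2| ≤ Δ) :
    P.total * P.m2 θ t ≤ P.total * (P.m2 θ' t + Δ) + kG * P.inputRadius LG kG α σ δ ^ α := by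
  have := hreg.prob
  have hd : (0 : ℝ) < dx := Nat.cast_pos.2 hdx
  have hm' : (0 : ℝ) < m := Nat.cast_pos.2 hm
  set r := P.inputRadius LG kG α σ δ with hr
  have hr0 : 0 ≤ r := inputRadius_nonneg σ.coe_nonneg
  have hint := fun θ (hθ : θ ∈ P.Θ) =>
    integrable_norm_G_sq hreg hΘ hinput hθ (hlip.G_lipschitz θ hθ t)
  -- For σ = 0 the constant 5 LG B/σ below makes no sense, but the input is almost surely 0, a point
  -- of the ball.
  rcases eq_or_ne σ 0 with rfl | hσ
  · have h0 : ∀ᵐ z ∂P.D, z = 0 := by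
      refine IsSubGaussianVec.ae_eq_zero ?_
      simpa using hinput
    have hle : P.m2 θ t ≤ P.m2 θ' t + Δ := by
      have : ∫ z, ‖P.G θ t z‖ ^ 2 ∂P.D ≤ ∫ z, (‖P.G θ' t z‖ ^ 2 + Δ) ∂P.D := by
        refine integral_mono_ae (hint θ hθ) ((hint θ' hθ').add (integrable_const _)) ?_
        filter_upwards [h0] with z hz
        have := (abs_le.1 (hΔ z (by rw [hz, norm_zero]; exact hr0))).2
        linarith
      rw [integral_add (hint θ' hθ') (integrable_const _)] at this
      simpa [m2] using this
    have : 0 ≤ kG * r ^ α := mul_nonneg hkG.le (Real.rpow_nonneg hr0 α)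
    have : P.total * P.m2 θ t ≤ P.total * (P.m2 θ' t + Δ) := by gcongr
    linarith
  have hσ0 : 0 < σ := pos_iff_ne_zero.2 hσ
  have hσ' : (0 : ℝ) < σ := hσ0
  have hbdd := bddAbove_m2 hreg hΘ hdx hkG hinput hLF hr0 hlip
  have hM : ∀ θ ∈ P.Θ, P.m2 θ t ≤ P.M2 := fun θ hθ => le_csSup hbdd ⟨θ, hθ, t, ht, rfl⟩
  have hG0 := fun θ hθ =>
    norm_G_zero_le hreg hΘ hdx hinput hLG hθ (hlip.G_lipschitz θ hθ t) (hM θ hθ)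
  set B := LG * σ + √P.M2 with hB
  have hBpos : 0 < B := by positivity
  have hBσ : LG * σ ≤ B := le_add_of_nonneg_right (Real.sqrt_nonneg _)
  have h3r : 3 * (σ : ℝ) ≤ r := three_mul_le_inputRadius hσ'.le
  have hmeas : MeasurableSet {z : Vec dx | r < ‖z‖} := measurableSet_lt (by fun_prop) (by fun_prop)
  have hpt : ∀ z, ‖P.G θ t z‖ ^ 2 ≤ ‖P.G θ' t z‖ ^ 2 + Δ
      + 5 * LG * B / σ * {z : Vec dx | r < ‖z‖}.indicator (fun z => ‖z‖ ^ 2) z := by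
    intro z
    by_cases hz : ‖z‖ ≤ r
    · rw [Set.indicator_of_notMem (by simpa using hz)]
      linarith [(abs_le.1 (hΔ z hz)).2]
    · have hz' : r < ‖z‖ := not_le.1 hz
      rw [Set.indicator_of_mem (by simpa using hz')]
      have h1 := (abs_le.1 (norm_G_sq_sub_le hLG.le (hlip.G_lipschitz θ hθ t) z)).2
      have h2 := (abs_le.1 (norm_G_sq_sub_le hLG.le (hlip.G_lipschitz θ' hθ' t) z)).1
      have h3 := (abs_le.1 (hΔ 0 (by simpa using hr0))).2
      have h4 : ∀ θ ∈ P.Θ, LG * ‖z‖ * (2 * ‖P.G θ t 0‖ + LG * ‖z‖)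
          ≤ LG * ‖z‖ * (4 * B + LG * ‖z‖) := by
        intro θ hθ
        have : 2 * ‖P.G θ t 0‖ ≤ 4 * B := by linarith [hG0 θ hθ]
        gcongr
      -- By ‖z‖ ≥ 3σ and LG σ ≤ B, the left side is at most (8/3 + 2) LG B ‖z‖²/σ. This is the use
      -- of the 3 in `inputRadius`.
      have h5 : 2 * (LG * ‖z‖ * (4 * B + LG * ‖z‖)) ≤ 5 * LG * B / σ * ‖z‖ ^ 2 := by
        have hzσ : 3 * (σ : ℝ) ≤ ‖z‖ := h3r.trans hz'.le
        rw [div_mul_eq_mul_div, le_div_iff₀ hσ']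
        have e1 : LG * ‖z‖ * B * (3 * σ) ≤ LG * ‖z‖ * B * ‖z‖ := by gcongr
        have e2 : LG * ‖z‖ ^ 2 * (LG * σ) ≤ LG * ‖z‖ ^ 2 * B := by gcongr
        nlinarith
      linarith [h4 θ hθ, h4 θ' hθ']
  have hind : Integrable ({z : Vec dx | r < ‖z‖}.indicator fun z => ‖z‖ ^ 2) P.D :=
    hinput.integrable_norm_sq.indicator hmeas
  have hle : P.m2 θ t ≤ P.m2 θ' t + Δ + 5 * LG * B / σ *
      ∫ z, {z : Vec dx | r < ‖z‖}.indicator (fun z => ‖z‖ ^ 2) z ∂P.D := by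
    have h1 : Integrable (fun z => ‖P.G θ' t z‖ ^ 2 + Δ) P.D :=
      (hint θ' hθ').add (integrable_const _)
    have : ∫ z, ‖P.G θ t z‖ ^ 2 ∂P.D ≤ ∫ z, (‖P.G θ' t z‖ ^ 2 + Δ
        + 5 * LG * B / σ * {z : Vec dx | r < ‖z‖}.indicator (fun z => ‖z‖ ^ 2) z) ∂P.D :=
      integral_mono (hint θ hθ) (h1.add (hind.const_mul _)) hpt
    rw [integral_add h1 (hind.const_mul _), integral_const_mul,
      integral_add (hint θ' hθ') (integrable_const _)] at this
    simpa [m2] using this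
  have hdN : (0 : NNReal) < dx := Nat.cast_pos.2 hdx
  have htail := hinput.integral_indicator_norm_sq_le (by positivity) hr0
  push_cast at htail
  have hrad := le_inputRadius_sq_div (P := P) (α := α) hσ' hdx hLG hkG hm hδ hδ1
  rw [← hr] at hrad
  set Λ := P.tailFactor LG kG α σ δ with hΛ
  have hΛ1 : 1 ≤ Λ := (one_le_four_mul_div hm hδ hδ1).trans (le_tailFactor hσ'.le hLG hkG hδ)
  have hΛpos : 0 < Λ := by linarith
  have htail2 : ∫ z, {z : Vec dx | r < ‖z‖}.indicator (fun z => ‖z‖ ^ 2) z ∂P.D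
      ≤ 4 * (σ : ℝ) ^ 2 / Λ := by
    have hd1 : (1 : ℝ) ≤ dx := Nat.one_le_cast.2 hdx
    have hexp : Real.exp (dx / 2 - r ^ 2 / (4 * ((σ : ℝ) ^ 2 / dx)) / 2) ≤ 1 / Λ := by
      rw [show 1 / Λ = Real.exp (-Real.log Λ) by
        rw [Real.exp_neg, Real.exp_log hΛpos, one_div]]
      exact Real.exp_le_exp.2 (by linarith)
    calc _ ≤ _ := htail
      _ ≤ 4 * ((σ : ℝ) ^ 2 / 1) * (1 / Λ) := by gcongr
      _ = _ := by ring
  have hfac := mul_le_tailFactor_mul (P := P) (α := α) hσ' hLG hkG hm hδ hδ1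
  rw [← hΛ, ← hB] at hfac
  have hK : kG * (σ : ℝ) ^ α ≤ kG * r ^ α := by
    have := rpow_le_inputRadius_rpow (P := P) (LG := LG) (kG := kG) (δ := δ) σ.coe_nonneg hα
    gcongr
  have hfin : P.total * (5 * LG * B / σ * (4 * (σ : ℝ) ^ 2 / Λ)) ≤ kG * (σ : ℝ) ^ α := by
    have : P.total * (5 * LG * B / σ * (4 * (σ : ℝ) ^ 2 / Λ))
        = 20 * (P.total * (LG * σ) * B) / Λ := by
      field_simp
      ring
    rw [this, div_le_iff₀ hΛpos]
    have : 0 ≤ P.total * (LG * σ) * B := by positivity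
    linarith
  calc P.total * P.m2 θ t ≤ P.total * (P.m2 θ' t + Δ + 5 * LG * B / σ * (4 * (σ : ℝ) ^ 2 / Λ)) := by
        gcongr
        exact hle.trans (by gcongr)
    _ = P.total * (P.m2 θ' t + Δ) + P.total * (5 * LG * B / σ * (4 * (σ : ℝ) ^ 2 / Λ)) := by ring
    _ ≤ _ := by linarith

/-! ### Deterministic error bound. -/

theorem sum_coef_mul_le (hreg : P.Regular) {F : Fin T × Fin m → ℝ} (hF : ∀ j, 0 ≤ F j) :
    ∑ j, P.coef j * F j ≤ P.maxRatio * ∑ j ∈ P.stored, F j := by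
  rw [stored, Finset.sum_filter, Finset.mul_sum]
  refine Finset.sum_le_sum fun j _ => ?_
  split_ifs with h
  · exact mul_le_mul_of_nonneg_right (P.coef_le_maxRatio hreg j) (hF j)
  · simp [coef, h]

/-- Each weight is the sum of the coefficients of its n_t samples. Hence an error of K/N per task
costs at most A K in the weighted population error. -/
theorem sum_w_le (hreg : P.Regular) (hn : ∀ t, 0 < P.w t → P.n t ≠ 0) :
    ∑ t, P.w t ≤ P.maxRatio * P.total := by
  have h1 := P.sum_coef_mul_fst hn hreg.w_nonneg fun _ => 1
  have h2 := sum_coef_mul_le hreg (F := fun _ => 1) fun _ => zero_le_one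
  rw [h1, Finset.sum_const, nsmul_eq_mul, mul_one, P.card_stored] at h2
  simpa using h2

theorem abs_empErr_sub_le (hreg : P.Regular) {ξ : Fin m → Vec dx} {θ θ' : Vec p} {Δ : ℝ}
    (hΔ0 : 0 ≤ Δ) (h : ∀ t i, |‖P.G θ t (ξ i)‖ ^ 2 - ‖P.G θ' t (ξ i)‖ ^ 2| ≤ Δ) :
    |P.empErr ξ θ - P.empErr ξ θ'| ≤ P.maxRatio * (P.total * Δ) := by
  rw [empErr, empErr, ← Finset.sum_sub_distrib]
  refine (Finset.abs_sum_le_sum_abs _ _).trans ?_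
  calc _ ≤ ∑ j, P.coef j * Δ := Finset.sum_le_sum fun j _ => by
        rw [← mul_sub, abs_mul, abs_of_nonneg (P.coef_nonneg hreg j)]
        exact mul_le_mul_of_nonneg_left (h j.1 j.2) (P.coef_nonneg hreg j)
    _ ≤ P.maxRatio * ∑ _j ∈ P.stored, Δ := sum_coef_mul_le hreg fun _ => hΔ0
    _ = _ := by rw [Finset.sum_const, nsmul_eq_mul, P.card_stored]

theorem noiseCorr_sub_le (hreg : P.Regular) {ξ : Fin m → Vec dx} {v : Fin T × Fin m → Vec dy}
    {θ θ' : Vec p} {Δ : ℝ} (hΔ0 : 0 ≤ Δ) (h : ∀ t i, ‖P.G θ t (ξ i) - P.G θ' t (ξ i)‖ ≤ Δ) :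
    P.noiseCorr ξ v θ - P.noiseCorr ξ v θ' ≤ P.maxRatio * (Δ * ∑ j ∈ P.stored, ‖v j‖) := by
  have h1 : P.noiseCorr ξ v θ - P.noiseCorr ξ v θ' ≤ ∑ j, P.coef j * (Δ * ‖v j‖) := by
    rw [noiseCorr, noiseCorr, ← Finset.sum_sub_distrib]
    refine Finset.sum_le_sum fun j _ => ?_
    rw [← mul_sub, ← inner_sub_left]
    refine mul_le_mul_of_nonneg_left ?_ (P.coef_nonneg hreg j)
    exact (real_inner_le_norm _ _).trans
      (mul_le_mul_of_nonneg_right (h j.1 j.2) (norm_nonneg _))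
  rw [Finset.mul_sum]
  exact h1.trans (sum_coef_mul_le hreg fun j => by positivity)

theorem sum_mul_m2_le_add {K Δ : ℝ} (hreg : P.Regular) (hn : ∀ t, 0 < P.w t → P.n t ≠ 0)
    (hN : 0 < P.total) (hK : 0 ≤ K) (hΔ0 : 0 ≤ Δ) {θ θ' : Vec p}
    (hm2 : ∀ t, 0 < P.w t → P.total * P.m2 θ t ≤ P.total * (P.m2 θ' t + Δ) + K) :
    ∑ t, P.w t * P.m2 θ t ≤ ∑ t, P.w t * P.m2 θ' t + P.maxRatio * (P.total * Δ + K) := by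
  have hN' : (0 : ℝ) < P.total := Nat.cast_pos.2 hN
  have h1 : ∑ t, P.w t * P.m2 θ t ≤ ∑ t, P.w t * (P.m2 θ' t + (Δ + K / P.total)) := by
    refine Finset.sum_le_sum fun t _ => ?_
    rcases (hreg.w_nonneg t).eq_or_lt with h | h
    · simp [← h]
    · have h3 := hm2 t h
      have h4 : P.total * (P.m2 θ' t + Δ) + K
          = P.total * (P.m2 θ' t + (Δ + K / P.total)) := by
        field_simp
        ring
      rw [h4] at h3
      exact mul_le_mul_of_nonneg_left (le_of_mul_le_mul_left h3 hN') h.le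
  have h2 : ∑ t, P.w t * (P.m2 θ' t + (Δ + K / P.total))
      = ∑ t, P.w t * P.m2 θ' t + (∑ t, P.w t) * (Δ + K / P.total) := by
    rw [Finset.sum_mul, ← Finset.sum_add_distrib]
    simp only [mul_add]
  have h3 : (∑ t, P.w t) * (Δ + K / P.total) ≤ P.maxRatio * (P.total * Δ + K) := by
    calc _ ≤ P.maxRatio * P.total * (Δ + K / P.total) :=
          mul_le_mul_of_nonneg_right (sum_w_le hreg hn) (by positivity)
      _ = _ := by field_simp
  linarith

/-- Deterministic part of the error bound: `θ'` is a point near the minimizer `θ` at which the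
noise is dominated by the empirical error, and the latter controls the population error. -/
theorem sum_mul_m2_le_of_isMinOn {K Lc c rv r Δ : ℝ} (hT : 0 < T) (hreg : P.Regular)
    (hΘ : P.BoundedRealizable) (hn : ∀ t, 0 < P.w t → P.n t ≠ 0) (hN : 0 < P.total) (hC : 1 < C)
    (hK : 0 ≤ K) (hrv : 0 ≤ rv) (hΔ0 : 0 ≤ Δ) (hΔ : P.total * Δ * (1 + 4 * rv) ≤ K)
    (hlam : P.lam ≤ c * (1 / (T : ℝ) * P.maxRatio))
    {ξ : Fin m → Vec dx} {v : Fin T × Fin m → Vec dy} {θ θ' : Vec p} (hθ : θ ∈ P.Θ)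
    (hmin : IsMinOn (P.objective ξ v) P.Θ θ)
    (hball : ∀ t z, ‖z‖ ≤ r → ‖P.G θ t z - P.G θ' t z‖ ≤ Δ)
    (hball_sq : ∀ t z, ‖z‖ ≤ r → |‖P.G θ t z‖ ^ 2 - ‖P.G θ' t z‖ ^ 2| ≤ Δ)
    (hm2 : ∀ t, 0 < P.w t → P.total * P.m2 θ t ≤ P.total * (P.m2 θ' t + Δ) + K)
    (hξ : ∀ i, ‖ξ i‖ ≤ r) (hv : ∑ j ∈ P.stored, ‖v j‖ ≤ P.total * rv)
    (hoff : 4 * P.noiseCorr ξ v θ' - P.empErr ξ θ' ≤ P.maxRatio * Lc)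
    (hiso : ∑ t, P.w t * P.m2 θ' t ≤ C * P.empErr ξ θ') :
    ∑ t, P.w t * P.m2 θ t ≤ (C * Lc + 4 * C * K + 2 * C * c * P.reg P.θstar) * P.maxRatio := by
  have hT' : (0 : ℝ) < T := Nat.cast_pos.2 hT
  have hpop := sum_mul_m2_le_add hreg hn hN hK hΔ0 hm2
  have habs := (abs_le.1 (abs_empErr_sub_le hreg hΔ0 fun t i => hball_sq t _ (hξ i))).1
  have hcorr := noiseCorr_sub_le (v := v) hreg hΔ0 fun t i => hball t _ (hξ i)
  have hbasic := P.empErr_le_of_isMinOn hT hreg hΘ hθ hmin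
  have hA := P.maxRatio_nonneg hreg
  have hR := hreg.reg_nonneg _ hΘ.2
  have hlam' : T * P.lam * P.reg P.θstar ≤ P.maxRatio * (c * P.reg P.θstar) := by
    calc T * P.lam * P.reg P.θstar ≤ T * (c * (1 / (T : ℝ) * P.maxRatio)) * P.reg P.θstar := by
          gcongr
      _ = _ := by field_simp
  have hcorr' : P.maxRatio * (Δ * ∑ j ∈ P.stored, ‖v j‖)
      ≤ P.maxRatio * (Δ * (P.total * rv)) := by gcongr
  have hN0 : 0 ≤ P.total * Δ := by positivity
  have hNK : P.maxRatio * (P.total * Δ) ≤ P.maxRatio * K := by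
    refine mul_le_mul_of_nonneg_left ?_ hA
    nlinarith [mul_nonneg hN0 hrv]
  have hNK' := mul_le_mul_of_nonneg_left hΔ hA
  -- Returning to `θ'` costs A N Δ twice for the empirical errors and 4 A N Δ `rv` for the
  -- correlation. By `hΔ` all of it is at most 2 A K.
  have hempθ' : P.empErr ξ θ'
      ≤ P.maxRatio * (Lc + 2 * K + 2 * (c * P.reg P.θstar)) := by linarith
  have hC' := mul_le_mul_of_nonneg_left hempθ' (zero_le_one.trans hC.le)
  have hAK : 1 * (P.maxRatio * (2 * K)) ≤ C * (P.maxRatio * (2 * K)) :=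
    mul_le_mul_of_nonneg_right hC.le (by positivity)
  linarith

/-- A bound on the ratio of L² norm to mean passes to nonnegative combinations, without
independence. Cauchy–Schwarz splits b_t H_t into the square roots of b_t E H_t and b_t H_t²/E H_t.
-/
theorem integral_sum_sq_le {E ι : Type*} [MeasurableSpace E] [Fintype ι] {D : Measure E}
    {H : ι → E → ℝ} (hH : ∀ t z, 0 ≤ H t z) (hH2 : ∀ t, Integrable (fun z => H t z ^ 2) D)
    {b : ι → ℝ} (hb : ∀ t, 0 ≤ b t) {k : ℝ}
    (hpos : ∀ t, 0 < b t → 0 < ∫ z, H t z ∂D)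
    (hk : ∀ t, 0 < b t → ∫ z, H t z ^ 2 ∂D ≤ k ^ 2 * (∫ z, H t z ∂D) ^ 2) :
    ∫ z, (∑ t, b t * H t z) ^ 2 ∂D ≤ k ^ 2 * (∑ t, b t * ∫ z, H t z ∂D) ^ 2 := by
  have hint0 : ∀ t, 0 ≤ b t * ∫ z, H t z ∂D := fun t =>
    mul_nonneg (hb t) (integral_nonneg (hH t))
  have hpt : ∀ z, (∑ t, b t * H t z) ^ 2
      ≤ (∑ t, b t * ∫ z, H t z ∂D) * ∑ t, b t / (∫ z, H t z ∂D) * H t z ^ 2 := by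
    intro z
    refine Finset.sum_sq_le_sum_mul_sum_of_sq_le_mul _ (fun t _ => hint0 t)
      (fun t _ => mul_nonneg (div_nonneg (hb t) (integral_nonneg (hH t))) (sq_nonneg _)) ?_
    intro t _
    rcases (hb t).eq_or_lt with h | h
    · simp [← h]
    · have := (hpos t h).ne'
      apply le_of_eq
      field_simp
  calc _ ≤ ∫ z, (∑ t, b t * ∫ z, H t z ∂D)
        * ∑ t, b t / (∫ z, H t z ∂D) * H t z ^ 2 ∂D :=
        integral_mono_of_nonneg (Filter.Eventually.of_forall fun z => sq_nonneg _)
          ((integrable_finsetSum _ fun t _ => (hH2 t).const_mul _).const_mul _)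
          (Filter.Eventually.of_forall hpt)
    _ = (∑ t, b t * ∫ z, H t z ∂D)
        * ∑ t, b t / (∫ z, H t z ∂D) * ∫ z, H t z ^ 2 ∂D := by
        rw [integral_const_mul, integral_finsetSum _ fun t _ => (hH2 t).const_mul _]
        simp only [integral_const_mul]
    _ ≤ (∑ t, b t * ∫ z, H t z ∂D) * ∑ t, k ^ 2 * (b t * ∫ z, H t z ∂D) := by
        refine mul_le_mul_of_nonneg_left (Finset.sum_le_sum fun t _ => ?_)
          (Finset.sum_nonneg fun t _ => hint0 t)
        rcases (hb t).eq_or_lt with h | h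
        · simp [← h]
        · have h1 := hpos t h
          calc _ ≤ b t / (∫ z, H t z ∂D) * (k ^ 2 * (∫ z, H t z ∂D) ^ 2) := by
                have := hk t h
                gcongr
            _ = _ := by field_simp
    _ = _ := by
        rw [← Finset.mul_sum]
        ring

end ReplayModel

/-! ### Probability bounds for the noise and the empirical error. -/

/-- Disintegration of the joint law: estimates proved for frozen inputs become estimates on the
sample space. -/
theorem lintegral_comp_prodMk_le_of_condDistrib {Ω α β : Type*} [MeasurableSpace Ω]
    [MeasurableSpace α] [MeasurableSpace β] [StandardBorelSpace β] [Nonempty β] {μ : Measure Ω}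
    [IsFiniteMeasure μ] {X : Ω → α} {Y : Ω → β} (hX : Measurable X) (hY : Measurable Y)
    {F : α × β → ENNReal} (hF : Measurable F) {A : ENNReal}
    (h : ∀ᵐ x ∂(μ.map X), ∫⁻ y, F (x, y) ∂(condDistrib Y X μ x) ≤ A) :
    ∫⁻ ω, F (X ω, Y ω) ∂μ ≤ A * μ Set.univ := by
  rw [← lintegral_map (f := F) hF (hX.prodMk hY), ← compProd_map_condDistrib hY.aemeasurable,
    Measure.lintegral_compProd hF]
  refine (lintegral_mono_ae h).trans_eq ?_
  rw [lintegral_const, Measure.map_apply hX MeasurableSet.univ, Set.preimage_univ]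

section Noise

variable {Ω : Type*} [MeasurableSpace Ω] {μ : Measure Ω} [IsProbabilityMeasure μ]
  {dx dy p T m : ℕ} {X : Fin m → Ω → Vec dx} {V : Fin T × Fin m → Ω → Vec dy} {ν : NNReal}

/-- Serves the case ν = 0, where the exponential moments used otherwise would divide by ν². -/
theorem IsCondSubGaussianNoise.ae_eq_zero (hX : ∀ i, Measurable (X i)) (hV : ∀ j, Measurable (V j))
    (h : IsCondSubGaussianNoise μ X V 0) : ∀ᵐ ω ∂μ, ∀ j, V j ω = 0 := by
  rw [ae_all_iff]
  intro j
  have hF : Measurable (Set.indicator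
      {a : (Fin m → Vec dx) × (Fin T × Fin m → Vec dy) | a.2 j ≠ 0} fun _ => (1 : ENNReal)) := by
    refine measurable_const.indicator (MeasurableSet.compl ?_)
    exact measurableSet_eq_fun ((measurable_pi_apply j).comp measurable_snd) measurable_const
  have hle := lintegral_comp_prodMk_le_of_condDistrib (μ := μ) (A := 0)
    (measurable_pi_lambda (fun ω i => X i ω) hX) (measurable_pi_lambda (fun ω j => V j ω) hV) hF (by
      filter_upwards [h] with ξ hξ
      have h0 := hξ.2 j
      rw [show (0 : NNReal) ^ 2 = 0 by norm_num] at h0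
      have h1 := ae_of_ae_map (measurable_pi_apply j).aemeasurable h0.ae_eq_zero
      rw [nonpos_iff_eq_zero]
      refine (lintegral_congr_ae ?_).trans lintegral_zero
      filter_upwards [h1] with v hv
      exact Set.indicator_of_notMem (by simpa using hv) _)
  rw [zero_mul, nonpos_iff_eq_zero] at hle
  have hcomp := hF.comp ((measurable_pi_lambda (fun ω i => X i ω) hX).prodMk
    (measurable_pi_lambda (fun ω j => V j ω) hV))
  filter_upwards [(lintegral_eq_zero_iff hcomp).1 hle] with ω hω
  by_contra hne
  rw [Function.comp_apply, Set.indicator_of_mem (by simpa using hne)] at hω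
  exact one_ne_zero hω

theorem IsCondSubGaussianNoise.lintegral_exp_norm_sq_le (hX : ∀ i, Measurable (X i))
    (hV : ∀ j, Measurable (V j)) (hν : 0 < ν) (h : IsCondSubGaussianNoise μ X V ν)
    (j : Fin T × Fin m) :
    ∫⁻ ω, ENNReal.ofReal (Real.exp (‖V j ω‖ ^ 2 / (4 * (ν : ℝ) ^ 2))) ∂μ
      ≤ ENNReal.ofReal (Real.exp (dy / 2)) := by
  have hF : Measurable fun a : (Fin m → Vec dx) × (Fin T × Fin m → Vec dy) =>
      ENNReal.ofReal (Real.exp (‖a.2 j‖ ^ 2 / (4 * (ν : ℝ) ^ 2))) := by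
    have : Measurable fun a : (Fin m → Vec dx) × (Fin T × Fin m → Vec dy) => a.2 j :=
      (measurable_pi_apply j).comp measurable_snd
    fun_prop
  have hle := lintegral_comp_prodMk_le_of_condDistrib (μ := μ)
    (A := ENNReal.ofReal (Real.exp (dy / 2)))
    (measurable_pi_lambda (fun ω i => X i ω) hX) (measurable_pi_lambda (fun ω j => V j ω) hV) hF (by
      filter_upwards [h] with ξ hξ
      have h1 := ((hξ.2 j).lintegral_exp_norm_sq_le (by positivity)).trans
        (ENNReal.ofReal_le_ofReal (sqrt_two_pow_le_exp dy))
      rw [lintegral_map (by fun_prop) (measurable_pi_apply j)] at h1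
      push_cast at h1
      exact h1)
  simpa using hle

/-- By convexity, an average norm above r forces the average of exp(‖v‖²/(4ν²)) above exp(r²/(4ν²));
Markov's inequality then applies to the sum. No union bound over samples is needed. -/
theorem IsCondSubGaussianNoise.measure_lt_sum_norm_le (hX : ∀ i, Measurable (X i))
    (hV : ∀ j, Measurable (V j)) (hν : 0 < ν) (h : IsCondSubGaussianNoise μ X V ν)
    {s : Finset (Fin T × Fin m)} (hs : s.Nonempty) {r : ℝ} (hr : 0 ≤ r) :
    μ {ω | s.card * r < ∑ j ∈ s, ‖V j ω‖}
      ≤ ENNReal.ofReal (Real.exp (dy / 2 - r ^ 2 / (4 * (ν : ℝ) ^ 2))) := by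
  have hν' : (0 : ℝ) < ν := hν
  have hcard : (0 : ℝ) < s.card := Nat.cast_pos.2 hs.card_pos
  set y₀ := r ^ 2 / (4 * (ν : ℝ) ^ 2) with hy₀
  set F : Ω → ENNReal := fun ω =>
    ∑ j ∈ s, ENNReal.ofReal (Real.exp (‖V j ω‖ ^ 2 / (4 * (ν : ℝ) ^ 2))) with hF
  have hFm : Measurable F := Finset.measurable_sum _ fun j _ => by
    have := hV j
    fun_prop
  have hsub : {ω | s.card * r < ∑ j ∈ s, ‖V j ω‖}
      ⊆ {ω | ENNReal.ofReal (s.card * Real.exp y₀) ≤ F ω} := by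
    intro ω hω
    have hω : s.card * r < ∑ j ∈ s, ‖V j ω‖ := hω
    rw [Set.mem_ofPred_eq, hF]
    simp only
    rw [← ENNReal.ofReal_sum_of_nonneg fun _ _ => (Real.exp_pos _).le]
    refine ENNReal.ofReal_le_ofReal ?_
    -- The tangent at r of the convex function u ↦ exp(u²/(4ν²)).
    have hpt : ∀ j ∈ s, Real.exp y₀ * (1 + 2 * r * (‖V j ω‖ - r) / (4 * (ν : ℝ) ^ 2))
        ≤ Real.exp (‖V j ω‖ ^ 2 / (4 * (ν : ℝ) ^ 2)) := by
      intro j _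
      have h1 := Real.add_one_le_exp (‖V j ω‖ ^ 2 / (4 * (ν : ℝ) ^ 2) - y₀)
      rw [Real.exp_sub, le_div_iff₀ (Real.exp_pos _)] at h1
      refine le_trans ?_ h1
      rw [mul_comm]
      refine mul_le_mul_of_nonneg_right ?_ (Real.exp_pos _).le
      have h2 : 2 * r * (‖V j ω‖ - r) / (4 * (ν : ℝ) ^ 2)
          ≤ (‖V j ω‖ ^ 2 - r ^ 2) / (4 * (ν : ℝ) ^ 2) := by
        gcongr
        nlinarith [sq_nonneg (‖V j ω‖ - r)]
      rw [sub_div] at h2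
      linarith
    refine le_trans ?_ (Finset.sum_le_sum hpt)
    rw [← Finset.mul_sum, Finset.sum_add_distrib, ← Finset.sum_div, ← Finset.mul_sum,
      Finset.sum_sub_distrib, Finset.sum_const, Finset.sum_const, nsmul_eq_mul, nsmul_eq_mul,
      mul_one, mul_comm]
    refine mul_le_mul_of_nonneg_left ?_ (Real.exp_pos _).le
    have : 0 ≤ 2 * r * (∑ j ∈ s, ‖V j ω‖ - s.card * r) / (4 * (ν : ℝ) ^ 2) := by
      have : 0 ≤ ∑ j ∈ s, ‖V j ω‖ - s.card * r := by linarith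
      positivity
    linarith
  calc _ ≤ _ := measure_mono hsub
    _ ≤ (∫⁻ ω, F ω ∂μ) / ENNReal.ofReal (s.card * Real.exp y₀) :=
      meas_ge_le_lintegral_div hFm.aemeasurable (by positivity) ENNReal.ofReal_ne_top
    _ ≤ ENNReal.ofReal (s.card * Real.exp (dy / 2)) / ENNReal.ofReal (s.card * Real.exp y₀) := by
      gcongr
      rw [hF, lintegral_finsetSum _ fun j _ => by
        have := hV j
        fun_prop]
      calc _ ≤ ∑ _j ∈ s, ENNReal.ofReal (Real.exp (dy / 2)) :=
            Finset.sum_le_sum fun j _ => h.lintegral_exp_norm_sq_le hX hV hν j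
        _ = _ := by
            rw [Finset.sum_const, nsmul_eq_mul, ENNReal.ofReal_mul (by positivity),
              ENNReal.ofReal_natCast]
    _ = _ := by
      rw [← ENNReal.ofReal_div_of_pos (by positivity), Real.exp_sub]
      congr 1
      field_simp

namespace ReplayModel

variable {P : ReplayModel dx dy p T m} {C ℓ δ : ℝ}

theorem noiseRadius_nonneg : 0 ≤ P.noiseRadius ν δ := by
  rw [noiseRadius]
  positivity

theorem measure_noiseRadius_lt_le (hX : ∀ i, Measurable (X i)) (hV : ∀ j, Measurable (V j))
    (h : IsCondSubGaussianNoise μ X V ν) (hN : 0 < P.total) (hm : 0 < m) (hδ : 0 < δ)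
    (hδ1 : δ ≤ 1) :
    μ {ω | P.total * P.noiseRadius ν δ < ∑ j ∈ P.stored, ‖V j ω‖} ≤ ENNReal.ofReal (δ / 4) := by
  rcases eq_or_ne ν 0 with rfl | hν
  · have h0 := h.ae_eq_zero hX hV
    refine (nonpos_iff_eq_zero.2 (measure_mono_null (t := {ω | ¬∀ j, V j ω = 0}) ?_
      (ae_iff.1 h0))).trans (zero_le)
    intro ω hω h0
    rw [Set.mem_ofPred_eq] at hω
    simp [h0, noiseRadius] at hω
  have hν0 : 0 < ν := pos_iff_ne_zero.2 hν
  have hν' : (0 : ℝ) < ν := hν0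
  have hs : P.stored.Nonempty := by
    rw [← Finset.card_pos, P.card_stored]
    exact hN
  have hmain := h.measure_lt_sum_norm_le hX hV hν0 hs (P.noiseRadius_nonneg (ν := ν) (δ := δ))
  rw [P.card_stored] at hmain
  refine hmain.trans (ENNReal.ofReal_le_ofReal ?_)
  have hm' : (1 : ℝ) ≤ m := Nat.one_le_cast.2 hm
  have h4 := one_le_four_mul_div hm hδ hδ1
  have hlog := Real.log_nonneg h4
  have hsq : (dy : ℝ) + Real.log (4 * m / δ) ≤ P.noiseRadius ν δ ^ 2 / (4 * (ν : ℝ) ^ 2) := by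
    rw [noiseRadius]
    have e : (2 * (ν : ℝ) * (√(dy : ℝ) + 8 * √(2 * Real.log (4 * m / δ)))) ^ 2
        / (4 * (ν : ℝ) ^ 2) = (√(dy : ℝ) + 8 * √(2 * Real.log (4 * m / δ))) ^ 2 := by
      field_simp
      ring
    rw [e]
    have e1 := Real.sq_sqrt (Nat.cast_nonneg (α := ℝ) dy)
    have e2 := Real.sq_sqrt (mul_nonneg zero_le_two hlog)
    have e3 := mul_nonneg (Real.sqrt_nonneg (dy : ℝ))
      (Real.sqrt_nonneg (2 * Real.log (4 * m / δ)))
    nlinarith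
  have hdy : (0 : ℝ) ≤ dy := Nat.cast_nonneg _
  calc _ ≤ Real.exp (-Real.log (4 * m / δ)) := Real.exp_le_exp.2 (by linarith)
    _ = δ / (4 * m) := by rw [Real.exp_neg, Real.exp_log (by positivity), inv_div]
    _ ≤ δ / 4 := by
      gcongr
      linarith

theorem empErr_nonneg (hreg : P.Regular) (ξ : Fin m → Vec dx) (θ : Vec p) : 0 ≤ P.empErr ξ θ :=
  Finset.sum_nonneg fun j _ => mul_nonneg (P.coef_nonneg hreg j) (by positivity)

theorem measure_lt_noiseCorr_sub_le (hX : ∀ i, Measurable (X i)) (hV : ∀ j, Measurable (V j))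
    (h : IsCondSubGaussianNoise μ X V ν) (hreg : P.Regular) (hΘ : P.BoundedRealizable)
    (hA : 0 < P.maxRatio) {θ : Vec p} (hθ : θ ∈ P.Θ) (ℓ : ℝ) :
    μ {ω | P.maxRatio * (8 * (ν : ℝ) ^ 2 * ℓ) < 4 * P.noiseCorr (fun i => X i ω)
      (fun j => V j ω) θ - P.empErr (fun i => X i ω) θ} ≤ ENNReal.ofReal (Real.exp (-ℓ)) := by
  rcases eq_or_ne ν 0 with rfl | hν
  · have h0 := h.ae_eq_zero hX hV
    refine (nonpos_iff_eq_zero.2 (measure_mono_null (t := {ω | ¬∀ j, V j ω = 0}) ?_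
      (ae_iff.1 h0))).trans (zero_le)
    intro ω hω h0
    rw [Set.mem_ofPred_eq] at hω
    have := empErr_nonneg hreg (fun i => X i ω) θ
    simp [h0, noiseCorr] at hω
    linarith
  have hν' : (0 : ℝ) < ν := NNReal.coe_pos.2 (pos_iff_ne_zero.2 hν)
  -- The largest s for which the offset dominates for all coefficients up to `maxRatio`.
  set s : ℝ := 1 / (8 * P.maxRatio * (ν : ℝ) ^ 2) with hs
  have hs0 : 0 < s := by positivity
  set F : (Fin m → Vec dx) × (Fin T × Fin m → Vec dy) → ENNReal := fun a =>
    ENNReal.ofReal (Real.exp (s * (4 * P.noiseCorr a.1 a.2 θ - P.empErr a.1 θ))) with hF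
  have hFm : Measurable F := by
    have hG : ∀ j : Fin T × Fin m, Measurable
        fun a : (Fin m → Vec dx) × (Fin T × Fin m → Vec dy) => P.G θ j.1 (a.1 j.2) := fun j =>
      (P.measurable_G hreg hΘ hθ j.1).comp ((measurable_pi_apply j.2).comp measurable_fst)
    have hv : ∀ j : Fin T × Fin m, Measurable
        fun a : (Fin m → Vec dx) × (Fin T × Fin m → Vec dy) => a.2 j := fun j =>
      (measurable_pi_apply j).comp measurable_snd
    have h1 : Measurable fun a : (Fin m → Vec dx) × (Fin T × Fin m → Vec dy) =>
        P.noiseCorr a.1 a.2 θ :=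
      Finset.measurable_sum _ fun j _ => ((hG j).inner (hv j)).const_mul _
    have h2 : Measurable fun a : (Fin m → Vec dx) × (Fin T × Fin m → Vec dy) =>
        P.empErr a.1 θ :=
      Finset.measurable_sum _ fun j _ => ((hG j).norm.pow_const 2).const_mul _
    exact (((h1.const_mul 4).sub h2).const_mul s).exp.ennreal_ofReal
  have hXm : Measurable fun ω i => X i ω := measurable_pi_lambda _ hX
  have hVm : Measurable fun ω j => V j ω := measurable_pi_lambda _ hV
  have hle := lintegral_comp_prodMk_le_of_condDistrib (μ := μ) (A := 1) hXm hVm hFm (by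
    filter_upwards [h] with ξ hξ
    refine lintegral_exp_offset_le_one hξ.1 hξ.2 (P.coef_nonneg hreg) (P.coef_le_maxRatio hreg)
      hs0.le (le_of_eq ?_) fun j => P.G θ j.1 (ξ j.2)
    rw [hs]
    field_simp)
  rw [measure_univ, one_mul] at hle
  have hsub : {ω | P.maxRatio * (8 * (ν : ℝ) ^ 2 * ℓ) < 4 * P.noiseCorr (fun i => X i ω)
      (fun j => V j ω) θ - P.empErr (fun i => X i ω) θ}
      ⊆ {ω | ENNReal.ofReal (Real.exp ℓ) ≤ F (fun i => X i ω, fun j => V j ω)} := by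
    intro ω hω
    rw [Set.mem_ofPred_eq] at hω
    refine ENNReal.ofReal_le_ofReal (Real.exp_le_exp.2 ?_)
    have e : ℓ = s * (P.maxRatio * (8 * (ν : ℝ) ^ 2 * ℓ)) := by
      rw [hs]
      field_simp
    rw [e]
    exact mul_le_mul_of_nonneg_left hω.le hs0.le
  calc _ ≤ _ := measure_mono hsub
    _ ≤ (∫⁻ ω, F (fun i => X i ω, fun j => V j ω) ∂μ) / ENNReal.ofReal (Real.exp ℓ) :=
      meas_ge_le_lintegral_div (hFm.comp (hXm.prodMk hVm)).aemeasurable (by positivity)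
        ENNReal.ofReal_ne_top
    _ ≤ 1 / ENNReal.ofReal (Real.exp ℓ) := by gcongr
    _ = _ := by
      rw [← ENNReal.ofReal_one, ← ENNReal.ofReal_div_of_pos (Real.exp_pos _), Real.exp_neg,
        one_div]

theorem measure_lt_sum_mul_m2_le (hX : ∀ i, Measurable (X i)) (hind : iIndepFun X μ)
    (hlaw : ∀ i, μ.map (X i) = P.D) (hreg : P.Regular) (hΘ : P.BoundedRealizable)
    (hmom : P.FiniteMoments) (hn0 : ∀ t, 0 < P.w t → P.n t ≠ 0) (hC : 1 < C) (hℓ : 0 ≤ ℓ) {k : ℝ}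
    (hn : ∀ t, 0 < P.w t → k ^ 2 * (2 * C ^ 2 / (C - 1) ^ 2 * ℓ) ≤ P.n t) {θ : Vec p}
    (hθ : θ ∈ P.Θ)
    (hk : P.f θ ≠ P.f P.θstar → ∀ t, 0 < P.w t → P.m4 θ t ≤ k ^ 2 * P.m2 θ t ^ 2) :
    μ {ω | C * P.empErr (fun i => X i ω) θ < ∑ t, P.w t * P.m2 θ t}
      ≤ ENNReal.ofReal (Real.exp (-ℓ)) := by
  have := hreg.prob
  have hw0 : ∀ t, 0 ≤ P.w t * P.m2 θ t := fun t =>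
    mul_nonneg (hreg.w_nonneg t) (P.m2_nonneg θ t)
  rcases (Finset.sum_nonneg fun t (_ : t ∈ Finset.univ) => hw0 t).eq_or_lt with hS | hS
  · have : {ω | C * P.empErr (fun i => X i ω) θ < ∑ t, P.w t * P.m2 θ t} = ∅ := by
      ext ω
      simp only [Set.mem_ofPred_eq, Set.mem_empty_iff_false, iff_false, not_lt, ← hS]
      exact mul_nonneg (by linarith) (empErr_nonneg hreg _ _)
    rw [this, measure_empty]
    exact zero_le
  have hne : P.f θ ≠ P.f P.θstar := by
    intro h
    simp [P.m2_eq_zero h] at hS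
  have hmeas : ∀ t, Measurable fun z => ‖P.G θ t z‖ ^ 2 := fun t =>
    (P.measurable_G hreg hΘ hθ t).norm.pow_const 2
  have h4 : ∀ t, Integrable (fun z => (‖P.G θ t z‖ ^ 2) ^ 2) P.D := fun t => by
    simpa only [← pow_mul] using (hmom θ hθ hne t).1
  have hL2 : ∀ t, MemLp (fun z => ‖P.G θ t z‖ ^ 2) 2 P.D := fun t =>
    (memLp_two_iff_integrable_sq (hmeas t).aestronglyMeasurable).2 (h4 t)
  -- Samples are grouped by trajectory: these variables are independent across i, while the tasks on
  -- one trajectory are functions of the same input.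
  set Y : Fin m → Vec dx → ℝ := fun i z => ∑ t, P.coef (t, i) * ‖P.G θ t z‖ ^ 2 with hY
  have hYL2 : ∀ i, MemLp (Y i) 2 P.D := fun i =>
    memLp_finsetSum _ fun t _ => (hL2 t).const_mul _
  have hYint : ∀ i, ∫ z, Y i z ∂P.D = ∑ t, P.coef (t, i) * P.m2 θ t := by
    intro i
    rw [hY]
    simp only
    rw [integral_finsetSum _ fun t _ => ((hL2 t).integrable one_le_two).const_mul _]
    simp only [integral_const_mul, m2]
  have hsum : ∑ i, ∫ z, Y i z ∂P.D = ∑ t, P.w t * P.m2 θ t := by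
    simp_rw [hYint]
    rw [← P.sum_coef_mul_fst hn0 hreg.w_nonneg, Fintype.sum_prod_type_right]
  have hemp : ∀ ω, P.empErr (fun i => X i ω) θ = ∑ i, Y i (X i ω) := by
    intro ω
    rw [empErr, Fintype.sum_prod_type_right]
  have hwpos : ∀ t i, 0 < P.coef (t, i) → 0 < P.w t := by
    intro t i h
    refine (hreg.w_nonneg t).lt_of_ne fun h0 => ?_
    simp [coef, ← h0] at h
  have hV2 : ∀ i, ∫ z, Y i z ^ 2 ∂P.D ≤ k ^ 2 * (∫ z, Y i z ∂P.D) ^ 2 := by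
    intro i
    rw [hYint]
    refine integral_sum_sq_le (fun t z => by positivity) h4 (fun t => P.coef_nonneg hreg _)
      (fun t h => (hmom θ hθ hne t).2) fun t h => ?_
    have := hk hne t (hwpos t i h)
    simp only [m4, m2] at this
    simpa only [← pow_mul] using this
  have hβ : 0 ≤ 2 * C ^ 2 / (C - 1) ^ 2 * ℓ := by positivity
  -- A trajectory carries at most w_t/n_t of the weight of task t, and n_t is at least the factor in
  -- front. So Σ (E Y_i)² times this factor is at most (Σ E Y_i)², the variance condition of the
  -- lower-tail bound.
  have hsingle : ∀ i, k ^ 2 * (2 * C ^ 2 / (C - 1) ^ 2 * ℓ) * ∫ z, Y i z ∂P.D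
      ≤ ∑ t, P.w t * P.m2 θ t := by
    intro i
    rw [hYint, Finset.mul_sum]
    refine Finset.sum_le_sum fun t _ => ?_
    rw [← mul_assoc]
    refine mul_le_mul_of_nonneg_right ?_ (P.m2_nonneg θ t)
    rcases (hreg.w_nonneg t).eq_or_lt with h | h
    · simp [coef, ← h]
    rw [coef]
    split_ifs
    · have hpos : (0 : ℝ) < P.n t := Nat.cast_pos.2 (Nat.pos_of_ne_zero (hn0 t h))
      calc _ ≤ P.n t * (P.w t / P.n t) := by
            gcongr
            exact hn t h
        _ = _ := by field_simp
    · simpa using hreg.w_nonneg t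
  have hiso := measureReal_sum_le_le_exp hX hind hlaw (Y := Y)
    (fun i => Finset.measurable_sum _ fun t _ => (hmeas t).const_mul _)
    (fun i z => Finset.sum_nonneg fun t _ => mul_nonneg (P.coef_nonneg hreg _) (by positivity))
    (fun i => (hYL2 i).integrable one_le_two) (fun i => (hYL2 i).integrable_sq) hC hℓ
    (by rw [hsum]; exact hS) (by
      calc _ ≤ (∑ i, k ^ 2 * (∫ z, Y i z ∂P.D) ^ 2) * (2 * C ^ 2 / (C - 1) ^ 2 * ℓ) := by
            gcongr with i
            exact hV2 i
        _ = ∑ i, (k ^ 2 * (2 * C ^ 2 / (C - 1) ^ 2 * ℓ) * ∫ z, Y i z ∂P.D)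
              * ∫ z, Y i z ∂P.D := by
            rw [Finset.sum_mul]
            refine Finset.sum_congr rfl fun i _ => ?_
            ring
        _ ≤ ∑ i, (∑ t, P.w t * P.m2 θ t) * ∫ z, Y i z ∂P.D := by
            refine Finset.sum_le_sum fun i _ => mul_le_mul_of_nonneg_right (hsingle i) ?_
            rw [hYint]
            exact Finset.sum_nonneg fun t _ =>
              mul_nonneg (P.coef_nonneg hreg _) (P.m2_nonneg θ t)
        _ = _ := by rw [← Finset.mul_sum, hsum, sq])
  rw [hsum] at hiso
  simp_rw [← hemp] at hiso
  rw [measureReal_def] at hiso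
  have hsub : {ω | C * P.empErr (fun i => X i ω) θ < ∑ t, P.w t * P.m2 θ t}
      ⊆ {ω | C * P.empErr (fun i => X i ω) θ ≤ ∑ t, P.w t * P.m2 θ t} := by
    intro ω hω
    rw [Set.mem_ofPred_eq] at hω ⊢
    exact hω.le
  exact (measure_mono hsub).trans
    ((ENNReal.le_ofReal_iff_toReal_le (measure_ne_top _ _) (Real.exp_pos _).le).2 hiso)

end ReplayModel
end Noise

/-! ### Union bound over the net and conclusion. -/

namespace ReplayModel

variable {dx dy p T m : ℕ} {P : ReplayModel dx dy p T m} {LF LG kG α q cLam C δ : ℝ}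
  {σ ν : NNReal}

theorem complexity_pos (hLF : 0 < LF) (hδ : 0 < δ) (hδ1 : δ ≤ 1) :
    0 < P.complexity LF ν δ := by
  have h1 : 0 ≤ P.noiseRadius ν δ := noiseRadius_nonneg
  have h2 : 0 ≤ Metric.diam P.Θ := Metric.diam_nonneg
  have h3 : 0 ≤ Real.log (1 + 2 * (LF * Metric.diam P.Θ) * P.total
      * (1 + 4 * P.noiseRadius ν δ)) := by
    refine Real.log_nonneg (le_add_of_nonneg_right ?_)
    positivity
  have h4 : 0 < Real.log (4 / δ) := by
    refine Real.log_pos ?_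
    rw [lt_div_iff₀ hδ]
    linarith
  rw [complexity]
  positivity

theorem exp_neg_complexity (hLF : 0 < LF) (hδ : 0 < δ) :
    (1 + 2 * (LF * Metric.diam P.Θ) * P.total * (1 + 4 * P.noiseRadius ν δ)) ^ p
      * Real.exp (-P.complexity LF ν δ) = δ / 4 := by
  have h1 : 0 ≤ P.noiseRadius ν δ := noiseRadius_nonneg
  have h2 : 0 ≤ Metric.diam P.Θ := Metric.diam_nonneg
  have h3 : 0 < 1 + 2 * (LF * Metric.diam P.Θ) * P.total * (1 + 4 * P.noiseRadius ν δ) := by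
    positivity
  rw [complexity, neg_add, Real.exp_add, Real.exp_neg, Real.exp_neg, Real.exp_nat_mul,
    Real.exp_log h3, Real.exp_log (by positivity), ← mul_assoc,
    mul_inv_cancel₀ (pow_pos h3 p).ne', one_mul, inv_div]

theorem m4_le_of_kappa_ne_top (hκ : P.kappa ≠ ⊤) (hmom : P.FiniteMoments) {θ : Vec p}
    (hθ : θ ∈ P.Θ) (hne : P.f θ ≠ P.f P.θstar) {t : Fin T} (ht : 0 < P.w t) :
    P.m4 θ t ≤ P.kappa.toReal ^ 2 * P.m2 θ t ^ 2 := by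
  have h1 : ENNReal.ofReal (√(P.m4 θ t) / P.m2 θ t) ≤ P.kappa :=
    le_iSup₂_of_le θ hθ (le_iSup₂_of_le hne t (le_iSup_of_le ht le_rfl))
  rw [ENNReal.ofReal_le_iff_le_toReal hκ, div_le_iff₀ (hmom θ hθ hne t).2] at h1
  have h0 : 0 ≤ P.m4 θ t := integral_nonneg fun _ => by positivity
  rw [← mul_pow, ← Real.sq_sqrt h0]
  gcongr

/-- A zero moment ratio would make the fourth moment vanish, hence the second, against
nondegeneracy. -/
theorem f_eq_of_kappa_eq_zero (hκ : P.kappa = 0) (hmom : P.FiniteMoments)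
    {θ : Vec p} (hθ : θ ∈ P.Θ) {t : Fin T} (ht : 0 < P.w t) : P.f θ = P.f P.θstar := by
  by_contra hne
  have h4 := m4_le_of_kappa_ne_top (by simp [hκ]) hmom hθ hne ht
  have hint := (hmom θ hθ hne t).1
  rw [hκ, ENNReal.toReal_zero, zero_pow two_ne_zero, zero_mul, m4] at h4
  have h0 := (integral_eq_zero_iff_of_nonneg (fun z => by positivity) hint).1
    (le_antisymm h4 (integral_nonneg fun z => by positivity))
  have hm2 : P.m2 θ t = 0 := by
    rw [m2, integral_congr_ae (g := fun _ => 0), integral_zero]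
    filter_upwards [h0] with z hz
    have : ‖P.G θ t z‖ = 0 := by simpa using hz
    rw [this]
    norm_num
  exact (hmom θ hθ hne t).2.ne' hm2

theorem err_eq_zero_of_f_eq {θ : Vec p} (h : P.f θ = P.f P.θstar) : P.err θ = 0 := by
  simp [P.err_eq, P.m2_eq_zero h]

theorem err_eq_zero_of_w (hreg : P.Regular) (h : ∀ t, ¬0 < P.w t) (θ : Vec p) : P.err θ = 0 := by
  have : ∀ t, P.w t = 0 := fun t => le_antisymm (not_lt.1 (h t)) (hreg.w_nonneg t)
  simp [P.err_eq, this]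

theorem bound_nonneg (hreg : P.Regular) (hΘ : P.BoundedRealizable) (hLF : 0 < LF) (hkG : 0 < kG)
    (hcLam : 0 ≤ cLam) (hC : 1 < C) (hδ : 0 < δ) (hδ1 : δ ≤ 1) :
    0 ≤ (8 * C * (ν : ℝ) ^ 2 * P.complexity LF ν δ
      + 4 * C * kG * P.inputRadius LG kG α σ δ ^ α
      + 2 * C * cLam * P.reg P.θstar) * (1 / (T : ℝ) * P.maxRatio) := by
  have h1 := (complexity_pos (P := P) (ν := ν) hLF hδ hδ1).le
  have h2 : 0 ≤ P.inputRadius LG kG α σ δ ^ α :=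
    Real.rpow_nonneg (inputRadius_nonneg σ.coe_nonneg) α
  have h3 := P.maxRatio_nonneg hreg
  have h4 := hreg.reg_nonneg _ hΘ.2
  have h5 : 0 ≤ C := by linarith
  positivity

theorem measure_bound_lt_err_le (hdx : 0 < dx) (hT : 0 < T) (hm : 0 < m)
    (hN : 0 < P.total) (hn0 : ∀ t, 0 < P.w t → P.n t ≠ 0) (hA : 0 < P.maxRatio)
    (hLF : 0 < LF) (hLG : 0 < LG) (hkG : 0 < kG) (hα : 0 < α) (hC : 1 < C) (hδ : 0 < δ)
    (hδ1 : δ ≤ 1) (hreg : P.Regular) (hinput : IsSubGaussianVec (σ ^ 2 / (dx : NNReal)) P.D)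
    (hΘ : P.BoundedRealizable) (hmom : P.FiniteMoments)
    (hlip : P.LipschitzConditions q LF LG (P.inputRadius LG kG α σ δ)
      (kG * P.inputRadius LG kG α σ δ ^ α))
    (hκ : P.kappa ≠ ⊤)
    (hn : ∀ t, 0 < P.w t →
      P.kappa.toReal ^ 2 * (2 * C ^ 2 / (C - 1) ^ 2 * P.complexity LF ν δ) ≤ P.n t)
    (hlam : P.lam ≤ cLam * (1 / (T : ℝ) * P.maxRatio))
    {Ω : Type*} [MeasurableSpace Ω] {μ : Measure Ω} [IsProbabilityMeasure μ]
    {X : Fin m → Ω → Vec dx} {V : Fin T × Fin m → Ω → Vec dy}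
    (hX : ∀ i, Measurable (X i)) (hV : ∀ j, Measurable (V j))
    (hind : iIndepFun X μ) (hlaw : ∀ i, μ.map (X i) = P.D) (hnoise : IsCondSubGaussianNoise μ X V ν)
    {θhat : Ω → Vec p} (hmem : ∀ᵐ ω ∂μ, θhat ω ∈ P.Θ)
    (hmin : ∀ᵐ ω ∂μ, IsMinOn (P.objective (fun i => X i ω) (fun j => V j ω)) P.Θ (θhat ω)) :
    μ {ω | (8 * C * (ν : ℝ) ^ 2 * P.complexity LF ν δ
          + 4 * C * kG * P.inputRadius LG kG α σ δ ^ α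
          + 2 * C * cLam * P.reg P.θstar) * (1 / (T : ℝ) * P.maxRatio)
        < P.err (θhat ω)} ≤ ENNReal.ofReal δ := by
  have hT' : (0 : ℝ) < T := Nat.cast_pos.2 hT
  have hm' : (0 : ℝ) < m := Nat.cast_pos.2 hm
  have hN' : (0 : ℝ) < P.total := Nat.cast_pos.2 hN
  set r := P.inputRadius LG kG α σ δ with hr
  set rv := P.noiseRadius ν δ with hrv
  set ℓ := P.complexity LF ν δ with hℓ
  set K := kG * r ^ α with hK
  have hr0 : 0 ≤ r := inputRadius_nonneg σ.coe_nonneg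
  have hrv0 : 0 ≤ rv := noiseRadius_nonneg
  have hℓ0 : 0 < ℓ := complexity_pos hLF hδ hδ1
  have hK0 : 0 ≤ K := mul_nonneg hkG.le (Real.rpow_nonneg hr0 α)
  -- Chosen so that Δ = K LF ε satisfies N Δ (1 + 4 rv) = K; the resulting bound on the net is the
  -- base of the power in `exp_neg_complexity`.
  set ε : ℝ := 1 / (LF * P.total * (1 + 4 * rv)) with hε
  have hε0 : 0 < ε := by positivity
  obtain ⟨net, hnetΘ, hnet, hcard⟩ := exists_finset_net hε0 hΘ.1
  have hcard' : net.card * Real.exp (-ℓ) ≤ δ / 4 := by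
    rw [← exp_neg_complexity (P := P) (ν := ν) hLF hδ]
    refine mul_le_mul_of_nonneg_right ?_ (Real.exp_pos _).le
    rw [finrank_euclideanSpace_fin] at hcard
    refine hcard.trans_eq ?_
    rw [← hrv]
    congr 2
    rw [hε]
    field_simp
  have hunion : ∀ E : Vec p → Set Ω, (∀ θ ∈ net, μ (E θ) ≤ ENNReal.ofReal (Real.exp (-ℓ))) →
      μ (⋃ θ ∈ net, E θ) ≤ ENNReal.ofReal (δ / 4) := by
    intro E hE
    calc _ ≤ ∑ θ ∈ net, μ (E θ) := measure_biUnion_finset_le _ _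
      _ ≤ ∑ _θ ∈ net, ENNReal.ofReal (Real.exp (-ℓ)) := Finset.sum_le_sum hE
      _ = ENNReal.ofReal (net.card * Real.exp (-ℓ)) := by
        rw [Finset.sum_const, nsmul_eq_mul, ENNReal.ofReal_mul (by positivity),
          ENNReal.ofReal_natCast]
      _ ≤ _ := ENNReal.ofReal_le_ofReal hcard'
  have hE1 : μ (⋃ i, {ω | r < ‖X i ω‖}) ≤ ENNReal.ofReal (δ / 4) := by
    have hone : ∀ i, μ {ω | r < ‖X i ω‖} ≤ ENNReal.ofReal (δ / (4 * m)) := by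
      intro i
      have := measure_inputRadius_lt_le (P := P) (α := α) hreg hdx hm hinput hLG hkG hδ hδ1
      rw [← hlaw i, Measure.map_apply (hX i)
        (measurableSet_lt measurable_const measurable_norm)] at this
      exact this
    calc _ ≤ ∑ i, μ {ω | r < ‖X i ω‖} := measure_iUnion_fintype_le _ _
      _ ≤ ∑ _i : Fin m, ENNReal.ofReal (δ / (4 * m)) := Finset.sum_le_sum fun i _ => hone i
      _ = ENNReal.ofReal (m * (δ / (4 * m))) := by
        rw [Finset.sum_const, nsmul_eq_mul, ENNReal.ofReal_mul (by positivity),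
          ENNReal.ofReal_natCast]
        simp
      _ = _ := by
        congr 1
        field_simp
  have hE2 := measure_noiseRadius_lt_le (P := P) hX hV hnoise hN hm hδ hδ1
  rw [← hrv] at hE2
  have hE3 := hunion _ fun θ hθ =>
    measure_lt_noiseCorr_sub_le hX hV hnoise hreg hΘ hA (hnetΘ hθ) ℓ
  have hE4 := hunion _ fun θ hθ =>
    measure_lt_sum_mul_m2_le hX hind hlaw hreg hΘ hmom hn0 hC hℓ0.le hn (hnetΘ hθ)
      fun hne t ht => m4_le_of_kappa_ne_top hκ hmom (hnetΘ hθ) hne ht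
  set E1 := ⋃ i, {ω | r < ‖X i ω‖}
  set E2 := {ω | P.total * rv < ∑ j ∈ P.stored, ‖V j ω‖}
  set E3 := ⋃ θ ∈ net, {ω | P.maxRatio * (8 * (ν : ℝ) ^ 2 * ℓ) < 4 * P.noiseCorr
    (fun i => X i ω) (fun j => V j ω) θ - P.empErr (fun i => X i ω) θ}
  set E4 := ⋃ θ ∈ net, {ω | C * P.empErr (fun i => X i ω) θ < ∑ t, P.w t * P.m2 θ t}
  -- The exceptional events concern fixed net points only, so the inclusion holds for whatever
  -- selection of minimizers, and outer measure suffices.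
  have hgood : ∀ᵐ ω ∂μ, ω ∈ {ω | (8 * C * (ν : ℝ) ^ 2 * ℓ + 4 * C * kG * r ^ α
        + 2 * C * cLam * P.reg P.θstar) * (1 / (T : ℝ) * P.maxRatio) < P.err (θhat ω)} →
      ω ∈ E1 ∪ E2 ∪ (E3 ∪ E4) := by
    filter_upwards [hmem, hmin] with ω hθ hmin hω
    by_contra hnot
    simp only [Set.mem_union, not_or] at hnot
    obtain ⟨⟨h1, h2⟩, h3, h4⟩ := hnot
    obtain ⟨θ', hθ'net, hdist⟩ := hnet _ hθ
    have hθ' : θ' ∈ P.Θ := hnetΘ hθ'net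
    simp only [E1, Set.mem_iUnion, Set.mem_ofPred_eq, not_exists, not_lt] at h1
    simp only [E2, Set.mem_ofPred_eq, not_lt] at h2
    simp only [E3, Set.mem_iUnion, Set.mem_ofPred_eq, not_exists, not_lt] at h3
    simp only [E4, Set.mem_iUnion, Set.mem_ofPred_eq, not_exists, not_lt] at h4
    have hΔ : K * P.fnorm q (fun z => P.f (θhat ω) z - P.f θ' z) ≤ K * (LF * ε) := by
      refine mul_le_mul_of_nonneg_left ?_ hK0
      refine (hlip.class_lipschitz _ hθ _ hθ').trans ?_
      rw [← dist_eq_norm]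
      gcongr
    have hball_sq : ∀ t z, ‖z‖ ≤ r →
        |‖P.G (θhat ω) t z‖ ^ 2 - ‖P.G θ' t z‖ ^ 2| ≤ K * (LF * ε) :=
      fun t z hz => (hlip.ball_sq _ hθ _ hθ' t z hz).trans hΔ
    have hfin := sum_mul_m2_le_of_isMinOn (Lc := 8 * (ν : ℝ) ^ 2 * ℓ) (rv := rv) (r := r)
      hT hreg hΘ hn0 hN hC hK0 hrv0 (Δ := K * (LF * ε)) (by positivity)
      (by
        rw [hε]
        apply le_of_eq
        field_simp)
      hlam hθ hmin (fun t z hz => (hlip.ball _ hθ _ hθ' t z hz).trans hΔ) hball_sq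
      (fun t ht => total_mul_m2_le hreg hΘ hdx hm hinput hLF hLG hkG hα hδ hδ1 hlip hθ hθ' ht
        (hball_sq t)) h1 h2 (h3 θ' hθ'net) (h4 θ' hθ'net)
    rw [P.err_eq] at hω
    refine absurd hω (not_lt.2 ?_)
    calc _ ≤ 1 / (T : ℝ) * ((C * (8 * (ν : ℝ) ^ 2 * ℓ) + 4 * C * K
          + 2 * C * cLam * P.reg P.θstar) * P.maxRatio) := by gcongr
      _ = _ := by
        rw [hK]
        ring
  calc _ ≤ μ (E1 ∪ E2 ∪ (E3 ∪ E4)) := measure_mono_ae hgood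
    _ ≤ (μ E1 + μ E2) + (μ E3 + μ E4) := (measure_union_le _ _).trans
        (add_le_add (measure_union_le _ _) (measure_union_le _ _))
    _ ≤ (ENNReal.ofReal (δ / 4) + ENNReal.ofReal (δ / 4))
        + (ENNReal.ofReal (δ / 4) + ENNReal.ofReal (δ / 4)) := by gcongr
    _ = _ := by
        rw [← ENNReal.ofReal_add (by positivity) (by positivity),
          ← ENNReal.ofReal_add (by positivity) (by positivity)]
        congr 1
        ring

end ReplayModel

theorem theorem1 {dx dy p T m : ℕ} (hdx : 0 < dx) (P : ReplayModel dx dy p T m)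
    (σ ν : NNReal) (q LF LG kG α cLam C δ : ℝ)
    (hq : 1 ≤ q) (hLF : 0 < LF) (hLG : 0 < LG) (hkG : 0 < kG) (hα : 0 < α)
    (hcLam : 0 ≤ cLam) (hC : 1 < C) (hδ : 0 < δ) (hδ1 : δ ≤ 1)
    -- standing conventions and assumptions on the model
    (hreg : P.Regular)
    (hinput : IsSubGaussianVec (σ ^ 2 / (dx : NNReal)) P.D)
    (hΘ : P.BoundedRealizable)
    (hLq : P.InLq q)
    (hmom : P.FiniteMoments)
    (hlip : P.LipschitzConditions q LF LG (P.inputRadius LG kG α σ δ)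
      (kG * P.inputRadius LG kG α σ δ ^ α))
    -- sufficiently many stored samples, small regularization parameter
    (hn : ∀ t, 0 < P.w t →
      P.kappa ^ 2 * ENNReal.ofReal (2 * C ^ 2 / (C - 1) ^ 2 * P.complexity LF ν δ)
        ≤ (P.n t : ENNReal))
    (hlam : P.lam ≤ cLam * (1 / (T : ℝ) * P.maxRatio))
    -- the samples and the minimizer
    {Ω : Type*} [MeasurableSpace Ω] (μ : MeasureTheory.Measure Ω)
    [MeasureTheory.IsProbabilityMeasure μ]
    (X : Fin m → Ω → Vec dx) (V : Fin T × Fin m → Ω → Vec dy)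
    (hX : ∀ i, Measurable (X i)) (hV : ∀ j, Measurable (V j))
    (hXindep : ProbabilityTheory.iIndepFun X μ) (hXlaw : ∀ i, μ.map (X i) = P.D)
    (hnoise : IsCondSubGaussianNoise μ X V ν)
    (θhat : Ω → Vec p)
    (hmem : ∀ᵐ ω ∂μ, θhat ω ∈ P.Θ)
    (hmin : ∀ᵐ ω ∂μ, IsMinOn (P.objective (fun i => X i ω) (fun j => V j ω)) P.Θ (θhat ω)) :
    μ {ω | (8 * C * (ν : ℝ) ^ 2 * P.complexity LF ν δ
          + 4 * C * kG * P.inputRadius LG kG α σ δ ^ α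
          + 2 * C * cLam * P.reg P.θstar) * (1 / (T : ℝ) * P.maxRatio)
        < P.err (θhat ω)} ≤ ENNReal.ofReal δ := by
  have hℓ := ReplayModel.complexity_pos (P := P) (ν := ν) hLF hδ hδ1
  have hzero : (∀ᵐ ω ∂μ, P.err (θhat ω) = 0) →
      μ {ω | (8 * C * (ν : ℝ) ^ 2 * P.complexity LF ν δ
          + 4 * C * kG * P.inputRadius LG kG α σ δ ^ α
          + 2 * C * cLam * P.reg P.θstar) * (1 / (T : ℝ) * P.maxRatio)
        < P.err (θhat ω)} ≤ ENNReal.ofReal δ := by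
    intro h
    have hb := ReplayModel.bound_nonneg (P := P) (LG := LG) (α := α) (σ := σ) (ν := ν)
      hreg hΘ hLF hkG hcLam hC hδ hδ1
    refine (nonpos_iff_eq_zero.2 (measure_mono_null (fun ω hω h0 => ?_) (ae_iff.1 h))).trans
      zero_le
    rw [Set.mem_ofPred_eq, h0] at hω
    exact absurd hω (not_lt.2 hb)
  by_cases hw : ∀ t, ¬0 < P.w t
  · exact hzero (Filter.Eventually.of_forall fun ω => ReplayModel.err_eq_zero_of_w hreg hw _)
  push Not at hw
  obtain ⟨t₀, ht₀⟩ := hw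
  have hβ : 0 < 2 * C ^ 2 / (C - 1) ^ 2 * P.complexity LF ν δ := by
    have : 0 < C - 1 := by linarith
    have : 0 < C := by linarith
    positivity
  -- An infinite κ would require infinitely many stored samples of the task `t₀`.
  have hκ : P.kappa ≠ ⊤ := by
    intro h
    have h1 := hn t₀ ht₀
    rw [h, ENNReal.top_pow two_ne_zero, ENNReal.top_mul (by simpa using hβ)] at h1
    exact ENNReal.natCast_ne_top _ (top_le_iff.1 h1)
  -- A task of positive weight may have no stored sample only if κ = 0. Then the class contains no
  -- predictor other than the true one, and the error is zero.
  by_cases hn0 : ∀ t, 0 < P.w t → P.n t ≠ 0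
  swap
  · push Not at hn0
    obtain ⟨t, ht, hnt⟩ := hn0
    have h1 := hn t ht
    rw [hnt, Nat.cast_zero, nonpos_iff_eq_zero, mul_eq_zero, or_iff_left (by simpa using hβ)] at h1
    have hκ0 : P.kappa = 0 := pow_eq_zero_iff two_ne_zero |>.1 h1
    refine hzero ?_
    filter_upwards [hmem] with ω hω
    exact ReplayModel.err_eq_zero_of_f_eq
      (ReplayModel.f_eq_of_kappa_eq_zero hκ0 hmom hω ht)
  have hnt₀ : 0 < P.n t₀ := Nat.pos_of_ne_zero (hn0 t₀ ht₀)
  have hnt₀' : (0 : ℝ) < P.n t₀ := Nat.cast_pos.2 hnt₀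
  have hT : 0 < T := t₀.pos
  have hm : 0 < m := by
    obtain ⟨i, -⟩ := Finset.card_pos.1 hnt₀
    exact i.pos
  have hN : 0 < P.total :=
    hnt₀.trans_le (Finset.single_le_sum (f := P.n) (fun _ _ => Nat.zero_le _)
      (Finset.mem_univ t₀))
  have hA : 0 < P.maxRatio := (div_pos ht₀ hnt₀').trans_le (P.ratio_le_maxRatio t₀)
  refine ReplayModel.measure_bound_lt_err_le hdx hT hm hN hn0 hA hLF hLG hkG hα hC hδ hδ1 hreg
    hinput hΘ hmom hlip hκ (fun t ht => ?_) hlam hX hV hXindep hXlaw hnoise hmem hmin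
  have h1 := ENNReal.toReal_mono (ENNReal.natCast_ne_top _) (hn t ht)
  rwa [ENNReal.toReal_mul, ENNReal.toReal_pow, ENNReal.toReal_ofReal hβ.le,
    ENNReal.toReal_natCast] at h1
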